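/- Let $\mathbb R^{4,1}=\mathbb R^4\oplus\langle t_0\rangle$ carry the inner product $(\,,\,)$ of signature $++++-$ with $(t_0,t_0)=-1$, and let $\mathbb P(\mathcal L)$ be the set of null lines in $\mathbb R^{4,1}$, identified with the unit sphere $S^3\subset\mathbb R^4$ by $x\mapsto\langle x+t_0\rangle$; this is the conformal $3$-sphere. Let $\mathfrak g=\mathfrak{so}(4,1)$, identified with $\wedge^2\mathbb R^{4,1}$ by $(u\wedge v)w=(u,w)v-(v,w)u$. For a null line $\ell$, the subspace $\ell\wedge\ell^\perp\subset\mathfrak g$ is the abelian nilradical of the stabiliser of $\ell$. Let $\Sigma$ be an oriented smooth surface and $f:\Sigma\to\mathbb P(\mathcal L)=S^3$ a smooth immersion. Equip $\Sigma$ with the complex structure given by its orientation and the conformal structure induced by $f$. Let $\mathrm I$ be the induced metric, let $\mathrm{I\!I}_0$ be the trace-free part of the second fundamental form, and let $F=f+t_0:\Sigma\to\mathbb R^{4,1}$ be the corresponding lift of $f$ to the light cone. For a smooth symmetric $(2,0)$-form $q$ on $\Sigma$ let $Q$ be the $\mathrm I$-symmetric endomorphism of $T\Sigma$ with $q+\bar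 q=\mathrm I(Q\,\cdot,\cdot)$. Write $[q,\mathrm{I\!I}_0]=0$ if $Q$ commutes with the endomorphism that represents $\mathrm{I\!I}_0$ with respect to $\mathrm I$. Let $\eta_q$ be the $\mathfrak g$-valued $1$-form $$\eta_q(X)=-\tfrac16\,F\wedge \mathrm dF(QX).$$ This is $q+\bar q$, viewed as a $1$-form with values in $T^*\Sigma\subset f^{-1}T^*S^3\cong f\wedge f^\perp$; the last isomorphism is given by the Killing form. Call $f$ *isothermic* if there is a holomorphic quadratic differential $q$ on $\Sigma$, not identically zero, with $[q,\mathrm{I\!I}_0]=0$. Then: 1. $f$ is isothermic if and only if there is a smooth $\eta\in\Omega^1(\mathfrak g)$, not identically zero, such that $\mathrm d\eta=0$ and $\eta$ takes values in $f\wedge f^\perp$. 2. For each smooth symmetric $(2,0)$-form $q$ on $\Sigma$, the $1$-form $\eta_q$ is smooth and takes values in $f\wedge f^\perp$; moreover, $q$ is holomorphic with $[q,\mathrm{I\!I}_0]=0$ if and only if $\mathrm d\eta_q=0$. 3. Conversely, each smooth closed $\eta\in\Omega^1(\mathfrak g)$ with values in $f\wedge f^\perp$ is equal to $\eta_q$ for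 some smooth symmetric $(2,0)$-form $q$ on $\Sigma$. -/

import Mathlib

open scoped Manifold ContDiff

noncomputable section

namespace Isothermic

/-! ### Minkowski space, the projective light cone, and the Lie algebra `so(4,1)` -/

/-- The vector space `ℝ⁴ ⊕ ℝ t₀`, with `t₀ = (0, 1)`. -/
abbrev R41 : Type := EuclideanSpace ℝ (Fin 4) × ℝ

/-- The Minkowski inner product of signature `++++-`. -/
def mink : LinearMap.BilinForm ℝ R41 :=
  LinearMap.mk₂ ℝ (fun u v => inner ℝ u.1 v.1 - u.2 * v.2)
    (fun u u' v => by simp [inner_add_left]; ring)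
    (fun c u v => by simp [real_inner_smul_left]; ring)
    (fun u v v' => by simp [inner_add_right]; ring)
    (fun c u v => by simp [real_inner_smul_right]; ring)

theorem mink_apply (u v : R41) : mink u v = inner ℝ u.1 v.1 - u.2 * v.2 := rfl

theorem mink_comm (u v : R41) : mink u v = mink v u := by
  simp [mink_apply, real_inner_comm, mul_comm]

/-- The projective light cone `ℙ(𝓛)`: lines through zero all of whose vectors are null. -/
def ProjLightCone : Type :=
  {p : Projectivization ℝ R41 // ∀ v ∈ p.submodule, mink v v = 0}

/-- The line in Minkowski space that is the point `p`. -/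
def ProjLightCone.line (p : ProjLightCone) : Submodule ℝ R41 := p.1.submodule

/-- The orthogonal complement of a subspace for the Minkowski inner product. -/
def perp (W : Submodule ℝ R41) : Submodule ℝ R41 where
  carrier := {v | ∀ u ∈ W, mink u v = 0}
  add_mem' := fun ha hb u hu => by simp [ha u hu, hb u hu]
  zero_mem' := fun u _ => by simp
  smul_mem' := fun c v hv u hu => by simp [hv u hu]

/-- The vector on a null line with last coordinate `1`, i.e. the vector `x + t₀` with `x` in the
unit sphere of `ℝ⁴`. The map `p ↦ x` is the standard conformal diffeomorphism `ℙ(𝓛) ≅ S³`. -/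
def ProjLightCone.vec (p : ProjLightCone) : R41 := (p.1.rep.2)⁻¹ • p.1.rep

theorem ProjLightCone.rep_mem (p : ProjLightCone) : p.1.rep ∈ p.line := by
  rw [ProjLightCone.line, Projectivization.submodule_eq]
  exact Submodule.mem_span_singleton_self _

theorem ProjLightCone.vec_mem (p : ProjLightCone) : p.vec ∈ p.line :=
  p.line.smul_mem _ p.rep_mem

theorem ProjLightCone.vec_snd (p : ProjLightCone) : p.vec.2 = 1 := by
  have h0 : p.1.rep.2 ≠ 0 := by
    intro h
    have hn := p.2 _ p.rep_mem
    rw [mink_apply, h] at hn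
    have h1 : p.1.rep.1 = 0 := by simpa using hn
    exact p.1.rep_nonzero (Prod.ext h1 h)
  simp [ProjLightCone.vec, h0]

/-- The Lie algebra `𝔤 = so(4,1)` of skew endomorphisms of Minkowski space. -/
def so41 : Submodule ℝ (R41 →L[ℝ] R41) where
  carrier := {A | ∀ u v, mink (A u) v + mink u (A v) = 0}
  add_mem' := fun {A B} ha hb u v => by
    have h1 := ha u v
    have h2 := hb u v
    simp only [add_apply, map_add, LinearMap.add_apply]
    linarith
  zero_mem' := fun u v => by simp
  smul_mem' := fun c A hA u v => by
    have h1 := hA u v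
    simp only [smul_apply, map_smul, LinearMap.smul_apply, smul_eq_mul]
    rw [← mul_add, h1, mul_zero]

/-- `u ∧ v` as an endomorphism: `(u ∧ v) w = (u, w) v - (v, w) u`. -/
def wedgeEnd (u v : R41) : R41 →L[ℝ] R41 :=
  (LinearMap.toContinuousLinearMap (mink u)).smulRight v -
    (LinearMap.toContinuousLinearMap (mink v)).smulRight u

theorem wedgeEnd_apply (u v w : R41) : wedgeEnd u v w = mink u w • v - mink v w • u := rfl

/-- `u ∧ v` as an element of `so(4,1)`, linear in `v`. -/
def wedge (u : R41) : R41 →ₗ[ℝ] so41 where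
  toFun v := ⟨wedgeEnd u v, fun a b => by
    simp only [wedgeEnd_apply, map_sub, map_smul, LinearMap.sub_apply, LinearMap.smul_apply,
      smul_eq_mul]
    rw [mink_comm a v, mink_comm a u]
    ring⟩
  map_add' v v' := by
    apply Subtype.ext
    apply ContinuousLinearMap.ext
    intro w
    simp only [Submodule.coe_add, add_apply, wedgeEnd_apply, map_add, LinearMap.add_apply]
    module
  map_smul' c v := by
    apply Subtype.ext
    apply ContinuousLinearMap.ext
    intro w
    simp only [Submodule.coe_smul, smul_apply, wedgeEnd_apply, map_smul, LinearMap.smul_apply,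
      smul_eq_mul, RingHom.id_apply]
    module

/-- The subspace `ℓ ∧ ℓ^⊥` of `so(4,1)`, for a null line `ℓ`: the nilradical of the stabiliser
of `ℓ`. -/
def nilradical (p : ProjLightCone) : Submodule ℝ so41 :=
  Submodule.span ℝ {A | ∃ u ∈ p.line, ∃ v ∈ perp p.line, A = wedge u v}

/-- The element `-(1/6) F ∧ v` of `so(4,1)`, as a linear function of `v`. It represents the
cotangent vector `A ↦ (v, A F)` of `T_{[F]} ℙ(𝓛) ≅ 𝔤 / 𝔭` through the Killing form
`(A, B) ↦ 3 tr (A B)` of `so(4,1)`. -/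
def killingDual (F : R41) : R41 →ₗ[ℝ] so41 := wedge F ∘ₗ ((-(1 / 6 : ℝ)) • LinearMap.id)

theorem killingDual_spec (F v : R41) (A : so41) :
    3 * LinearMap.trace ℝ R41 ((A.1 : R41 →ₗ[ℝ] R41) ∘ₗ ((killingDual F v).1 : R41 →ₗ[ℝ] R41))
      = mink v (A.1 F) := by
  have h : ((A.1 : R41 →ₗ[ℝ] R41) ∘ₗ ((killingDual F v).1 : R41 →ₗ[ℝ] R41))
      = (-(1 / 6 : ℝ)) • ((mink F).smulRight (A.1 v) - (mink v).smulRight (A.1 F)) := by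
    apply LinearMap.ext
    intro w
    simp [killingDual, wedge, wedgeEnd_apply]
    module
  have h2 := A.2 F v
  rw [h, map_smul, map_sub, LinearMap.trace_smulRight, LinearMap.trace_smulRight,
    mink_comm v (A.1 F), smul_eq_mul]
  linarith

/-! ### Surfaces -/

/-- The endomorphism `A` with `g (A X, Y) = b (X, Y)`, for a nondegenerate form `g`. -/
def raise {T : Type*} [AddCommGroup T] [Module ℝ T] [FiniteDimensional ℝ T]
    (g b : LinearMap.BilinForm ℝ T) : T →ₗ[ℝ] T :=
  open Classical in
  if h : g.Nondegenerate then b.symmCompOfNondegenerate g h else 0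

theorem raise_spec {T : Type*} [AddCommGroup T] [Module ℝ T] [FiniteDimensional ℝ T]
    (g b : LinearMap.BilinForm ℝ T) (hg : g.Nondegenerate) (X Y : T) :
    g (raise g b X) Y = b X Y := by
  rw [raise, dif_pos hg]
  exact LinearMap.BilinForm.symmCompOfNondegenerate_left_apply b hg Y X

section Surface

variable {M : Type*} [TopologicalSpace M] [ChartedSpace (EuclideanSpace ℝ (Fin 2)) M]

/-- The tangent plane at a point of a surface. -/
abbrev Tan (x : M) : Type := TangentSpace (𝓡 2) x

instance finiteDimensional_tan (x : M) : FiniteDimensional ℝ (Tan x) :=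
  inferInstanceAs (FiniteDimensional ℝ (EuclideanSpace ℝ (Fin 2)))

/-- The derivative of a vector-valued function `g` at `x`. -/
def der {W : Type*} [NormedAddCommGroup W] [NormedSpace ℝ W] (g : M → W) (x : M) :
    Tan x →ₗ[ℝ] W :=
  (mfderiv (𝓡 2) 𝓘(ℝ, W) g x).toLinearMap

/-- Smoothness of a vector-valued function on a set. -/
def SmoothOn {W : Type*} [NormedAddCommGroup W] [NormedSpace ℝ W] (g : M → W) (U : Set M) : Prop :=
  ContMDiffOn (𝓡 2) 𝓘(ℝ, W) ∞ g U

/-- Smoothness of a vector field on a set. -/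
def SmoothField [IsManifold (𝓡 2) ∞ M] (X : ∀ x : M, Tan x) (U : Set M) : Prop :=
  ContMDiffOn (𝓡 2) (𝓡 2).tangent ∞ (fun x => (⟨x, X x⟩ : TangentBundle (𝓡 2) M)) U

/-- The pair `X, Y` is a basis in the orientation `o`. -/
def PositiveBasis {T : Type*} [AddCommGroup T] [Module ℝ T] (o : Orientation ℝ T (Fin 2))
    (X Y : T) : Prop :=
  ∃ b : Module.Basis (Fin 2) ℝ T, b 0 = X ∧ b 1 = Y ∧ b.orientation = o

variable (M) in
/-- An orientation of a surface: a choice of orientation of every tangent plane, such that there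
are positive smooth frames near every point. -/
structure SurfaceOrientation [IsManifold (𝓡 2) ∞ M] where
  /-- The orientation of the tangent plane at `x`. -/
  at_pt : ∀ x : M, Orientation ℝ (Tan x) (Fin 2)
  exists_frame : ∀ x : M, ∃ U : Set M, IsOpen U ∧ x ∈ U ∧ ∃ X Y : ∀ y : M, Tan y,
    SmoothField X U ∧ SmoothField Y U ∧ ∀ y ∈ U, PositiveBasis (at_pt y) (X y) (Y y)

/-! ### Differential forms with values in `so(4,1)` -/

variable (M) in
/-- One-forms with values in `so(4,1)`, not necessarily smooth. -/
abbrev OneForm : Type _ := ∀ x : M, Tan x →ₗ[ℝ] so41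

/-- A one-form is smooth if it takes smooth vector fields to smooth functions. -/
def OneForm.IsSmooth [IsManifold (𝓡 2) ∞ M] (η : OneForm M) : Prop :=
  ∀ (U : Set M) (X : ∀ x : M, Tan x), IsOpen U → SmoothField X U →
    SmoothOn (fun x => η x (X x)) U

/-- `dη = 0`, where `dη (X, Y) = X (η Y) - Y (η X) - η [X, Y]`. -/
def OneForm.IsClosed [IsManifold (𝓡 2) ∞ M] (η : OneForm M) : Prop :=
  ∀ (U : Set M) (X Y : ∀ x : M, Tan x), IsOpen U → SmoothField X U → SmoothField Y U → ∀ x ∈ U,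
    der (fun y => η y (Y y)) x (X x) - der (fun y => η y (X y)) x (Y x)
      - η x (VectorField.mlieBracket (𝓡 2) X Y x) = 0

/-- The one-form takes values in the bundle `f ∧ f^⊥`. -/
def OneForm.TakesValuesInNilradical (η : OneForm M) (f : M → ProjLightCone) : Prop :=
  ∀ (x : M) (X : Tan x), η x X ∈ nilradical (f x)

/-! ### Immersions into `S³ = ℙ(𝓛)` -/

/-- The lift `φ + t₀` of `f`, where `φ` is `f` viewed as a map to the unit sphere of `ℝ⁴`. -/
def lift (f : M → ProjLightCone) (x : M) : R41 := (f x).vec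

/-- A smooth immersion into `ℙ(𝓛) ≅ S³`. -/
def IsImmersion (f : M → ProjLightCone) : Prop :=
  SmoothOn (lift f) Set.univ ∧ ∀ x : M, Function.Injective (der (lift f) x)

/-- The metric `I (X, Y) = (dF X, dF Y)` induced on the surface by the lift `F = φ + t₀`. Its
conformal class is the one induced by the conformal structure of `ℙ(𝓛)`. -/
def firstForm (f : M → ProjLightCone) (x : M) : LinearMap.BilinForm ℝ (Tan x) :=
  mink.compl₁₂ (der (lift f) x) (der (lift f) x)

/-- `N` is on `U` a smooth unit normal field of `f` in the unit sphere of `ℝ⁴`. -/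
structure IsUnitNormal (f : M → ProjLightCone) (N : M → R41) (U : Set M) : Prop where
  smooth : SmoothOn N U
  tangent_sphere : ∀ x ∈ U, (N x).2 = 0 ∧ mink (N x) (lift f x) = 0
  normal : ∀ x ∈ U, ∀ X : Tan x, mink (N x) (der (lift f) x X) = 0
  unit : ∀ x ∈ U, mink (N x) (N x) = 1

/-- The second fundamental form `II (X, Y) = -(dN X, dF Y)`. -/
def secondForm (f : M → ProjLightCone) (N : M → R41) (x : M) : LinearMap.BilinForm ℝ (Tan x) :=
  -(mink.compl₁₂ (der N x) (der (lift f) x))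

/-- The trace-free part `II₀` of the second fundamental form. -/
def tracefreeSecondForm (f : M → ProjLightCone) (N : M → R41) (x : M) :
    LinearMap.BilinForm ℝ (Tan x) :=
  secondForm f N x
    - ((1 / 2 : ℝ) * LinearMap.trace ℝ (Tan x) (raise (firstForm f x) (secondForm f N x)))
      • firstForm f x

/-! ### Quadratic differentials -/

variable (M) in
/-- Complex-valued real-bilinear forms on the tangent planes. -/
abbrev BilinField : Type _ := ∀ x : M, Tan x →ₗ[ℝ] Tan x →ₗ[ℝ] ℂ

/-- `X, Y` is a positively oriented conformal frame for the induced conformal structure, i.e.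
`X ≠ 0` and `Y = J X`, where `J` is the rotation by a right angle. -/
def IsConformalPair [IsManifold (𝓡 2) ∞ M] (o : SurfaceOrientation M) (f : M → ProjLightCone)
    (x : M) (X Y : Tan x) : Prop :=
  PositiveBasis (o.at_pt x) X Y ∧ firstForm f x X X = firstForm f x Y Y ∧ firstForm f x X Y = 0

/-- `q` is a (smooth) symmetric `(2,0)`-form for the complex structure `J` that is given by the
orientation and the induced conformal structure: `q (J X, Z) = i q (X, Z)`. -/
structure IsQuadraticDifferential [IsManifold (𝓡 2) ∞ M] (o : SurfaceOrientation M)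
    (f : M → ProjLightCone) (q : BilinField M) : Prop where
  smooth : ∀ (U : Set M) (X Y : ∀ x : M, Tan x), IsOpen U → SmoothField X U → SmoothField Y U →
    SmoothOn (fun x => q x (X x) (Y x)) U
  symm : ∀ (x : M) (X Y : Tan x), q x X Y = q x Y X
  type_two_zero : ∀ (x : M) (X Y : Tan x), IsConformalPair o f x X Y →
    ∀ Z : Tan x, q x Y Z = Complex.I * q x X Z

/-- `q` is holomorphic: `∂̄ q = 0`. For a local vector field `Z = X - i Y` of type `(1,0)`, with
`Y = J X`, the Cauchy-Riemann operator is `(∂̄_Z̄ q) (Z, Z) = Z̄ (q (Z, Z)) - 2 q ([Z̄, Z], Z)`, which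
for a `(2,0)`-form `q` is four times the expression below. If `X = ∂/∂x` and `Y = ∂/∂y` for a
holomorphic coordinate `x + i y`, so that `[X, Y] = 0` and `q = h (dx + i dy)²` with
`h = q (X, X)`, this is the Cauchy-Riemann equation `h_x + i h_y = 0`. -/
def IsHolomorphic [IsManifold (𝓡 2) ∞ M] (o : SurfaceOrientation M)
    (f : M → ProjLightCone) (q : BilinField M) : Prop :=
  ∀ (U : Set M) (X Y : ∀ x : M, Tan x), IsOpen U → SmoothField X U → SmoothField Y U →
    (∀ x ∈ U, IsConformalPair o f x (X x) (Y x)) → ∀ x ∈ U,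
      der (fun y => q y (X y) (X y)) x (X x) + Complex.I * der (fun y => q y (X y) (X y)) x (Y x)
        + 2 * Complex.I * q x (VectorField.mlieBracket (𝓡 2) X Y x) (X x) = 0

/-- The real symmetric form `q + q̄`. -/
def realForm (q : BilinField M) (x : M) : LinearMap.BilinForm ℝ (Tan x) :=
  (2 : ℝ) • (q x).compr₂ Complex.reLm

/-- The endomorphism `Q` with `q + q̄ = I (Q · , ·)`. -/
def quadEnd (f : M → ProjLightCone) (q : BilinField M) (x : M) : Tan x →ₗ[ℝ] Tan x :=
  raise (firstForm f x) (realForm q x)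

/-- `[q, II₀] = 0`: the symmetric endomorphisms that represent `q + q̄` and `II₀` commute. -/
def CommutesWithSecondForm (f : M → ProjLightCone) (q : BilinField M) : Prop :=
  ∀ (U : Set M) (N : M → R41), IsOpen U → IsUnitNormal f N U → ∀ x ∈ U,
    quadEnd f q x ∘ₗ raise (firstForm f x) (tracefreeSecondForm f N x)
      = raise (firstForm f x) (tracefreeSecondForm f N x) ∘ₗ quadEnd f q x

/-- `f` is isothermic: there is a nonzero holomorphic quadratic differential that commutes with
the second fundamental form. -/
def IsIsothermic [IsManifold (𝓡 2) ∞ M] (o : SurfaceOrientation M) (f : M → ProjLightCone) :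
    Prop :=
  ∃ q : BilinField M, IsQuadraticDifferential o f q ∧ (∃ x, q x ≠ 0) ∧
    IsHolomorphic o f q ∧ CommutesWithSecondForm f q

/-- The `so(4,1)`-valued one-form `η` given by `q + q̄`, viewed as a one-form with values in
`T*Σ ⊆ f⁻¹ T*S³ ≅ f ∧ f^⊥`. Here `(q + q̄) (X, · ) = (dF (Q X), dF · )` becomes the cotangent
vector `A ↦ (dF (Q X), A F)` of `S³`, which vanishes on the normal of `f`. The result does not
depend on the choice of the lift `F`. -/
def associatedForm (f : M → ProjLightCone) (q : BilinField M) : OneForm M := fun x =>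
  killingDual (lift f x) ∘ₗ der (lift f) x ∘ₗ quadEnd f q x

end Surface

end Isothermic

end

/-!
Every form with values in `f ∧ f^⊥` is `F ∧ θ` for an `ℝ⁴`-valued one-form `θ` with `θ ⟂ f`, and
`d(F ∧ θ) = dF ∧ θ + F ∧ dθ`. Pairing with `t₀` separates the two terms: `F ∧ θ` is closed if and
only if `dθ = 0` and `dF X ∧ θ Y = dF Y ∧ θ X`. The second condition says that `θ = dF ∘ A` with
`A` symmetric and trace-free, and such `A` are exactly the endomorphisms `-Q / 6` of
`(2,0)`-forms `q`. For these, `dθ` has no `f`-component, its tangential part is the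
Cauchy–Riemann operator of `q`, because the Levi-Civita connection is torsion-free, and its normal
part is the commutator of `Q` with the second fundamental form.
-/

noncomputable section

namespace Isothermic

/-! ### Exterior derivatives of vector-valued one-forms -/

section Manifold

variable {E H M : Type*} [NormedAddCommGroup E] [NormedSpace ℝ E] [TopologicalSpace H]
  {I : ModelWithCorners ℝ E H} [TopologicalSpace M] [ChartedSpace H M]
  {W W₁ W₂ : Type*} [NormedAddCommGroup W] [NormedSpace ℝ W]
  [NormedAddCommGroup W₁] [NormedSpace ℝ W₁] [NormedAddCommGroup W₂] [NormedSpace ℝ W₂]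

open VectorField in
theorem fderiv_comp_extChartAt_symm_mpullback [I.Boundaryless] [IsManifold I 1 M]
    {g : M → W} {x : M} {p : E} (hp : p ∈ (extChartAt I x).target)
    (hg : MDifferentiableAt I 𝓘(ℝ, W) g ((extChartAt I x).symm p))
    (Z : ∀ y : M, TangentSpace I y) :
    fderiv ℝ (g ∘ (extChartAt I x).symm) p (mpullback 𝓘(ℝ, E) I (extChartAt I x).symm Z p)
      = mvfderiv I g ((extChartAt I x).symm p) (Z ((extChartAt I x).symm p)) := by
  have hs := mdifferentiableWithinAt_extChartAt_symm (I := I) hp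
  have hi := isInvertible_mfderivWithin_extChartAt_symm (I := I) hp
  simp only [I.range_eq_univ, mdifferentiableWithinAt_univ, mfderivWithin_univ] at hs hi
  rw [← mfderiv_eq_fderiv, mfderiv_comp p hg hs, mpullback_apply]
  exact congrArg _ (hi.self_apply_inverse _)

open VectorField in
theorem differentiableAt_mpullback_extChartAt_symm [I.Boundaryless] [CompleteSpace E]
    [IsManifold I 2 M] {Z : ∀ y : M, TangentSpace I y} {x : M}
    (hZ : MDifferentiableAt I I.tangent (fun y => (⟨y, Z y⟩ : TangentBundle I M)) x) :
    DifferentiableAt ℝ (mpullback 𝓘(ℝ, E) I (extChartAt I x).symm Z) (extChartAt I x x) := by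
  rw [← mdifferentiableWithinAt_univ] at hZ
  have h := hZ.differentiableWithinAt_mpullbackWithin_vectorField
  simp only [I.range_eq_univ, mpullbackWithin_univ, Set.preimage_univ, Set.univ_inter] at h
  exact h.differentiableAt Filter.univ_mem

open VectorField in
theorem mpullback_extChartAt_symm_mlieBracket [I.Boundaryless] [CompleteSpace E]
    [IsManifold I 3 M] {X Y : ∀ y : M, TangentSpace I y} {x : M}
    (hX : MDifferentiableAt I I.tangent (fun y => (⟨y, X y⟩ : TangentBundle I M)) x)
    (hY : MDifferentiableAt I I.tangent (fun y => (⟨y, Y y⟩ : TangentBundle I M)) x) :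
    mpullback 𝓘(ℝ, E) I (extChartAt I x).symm (mlieBracket I X Y) (extChartAt I x x)
      = lieBracket ℝ (mpullback 𝓘(ℝ, E) I (extChartAt I x).symm X)
        (mpullback 𝓘(ℝ, E) I (extChartAt I x).symm Y) (extChartAt I x x) := by
  have : IsManifold I (minSmoothness ℝ 3) M := by simpa
  have : IsManifold I 2 M := .of_le (n := 3) (by norm_cast)
  have hx : (extChartAt I x).symm (extChartAt I x x) = x := extChartAt_to_inv x
  have hψ := contMDiffWithinAt_extChartAt_symm_range (I := I) (n := 2) x (mem_extChartAt_target x)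
  rw [I.range_eq_univ, contMDiffWithinAt_univ] at hψ
  rw [mpullback_mlieBracket (by rwa [hx]) (by rwa [hx]) hψ (by simp), ← mlieBracketWithin_univ,
    mlieBracketWithin_eq_lieBracketWithin]
  exact congrFun (lieBracketWithin_univ (𝕜 := ℝ) (E := E)) _

theorem mvfderiv_mvfderiv_eq_fderiv_fderiv [I.Boundaryless] [IsManifold I 1 M] {g : M → W}
    {Y : ∀ y : M, TangentSpace I y} {x : M}
    (hg : ∀ᶠ y in nhds x, MDifferentiableAt I 𝓘(ℝ, W) g y)
    (hYg : MDifferentiableAt I 𝓘(ℝ, W) (fun y => mvfderiv I g y (Y y)) x)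
    (X : ∀ y : M, TangentSpace I y) :
    mvfderiv I (fun y => mvfderiv I g y (Y y)) x (X x)
      = fderiv ℝ (fun q => fderiv ℝ (g ∘ (extChartAt I x).symm) q
          (VectorField.mpullback 𝓘(ℝ, E) I (extChartAt I x).symm Y q)) (extChartAt I x x)
        (VectorField.mpullback 𝓘(ℝ, E) I (extChartAt I x).symm X (extChartAt I x x)) := by
  have hx : (extChartAt I x).symm (extChartAt I x x) = x := extChartAt_to_inv x
  have hxt := mem_extChartAt_target (I := I) x
  have h := fderiv_comp_extChartAt_symm_mpullback (g := fun y => mvfderiv I g y (Y y)) hxt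
    (by rwa [hx]) X
  rw [hx] at h
  rw [← h]
  have htarget : ∀ᶠ q in nhds (extChartAt I x x), q ∈ (extChartAt I x).target :=
    extChartAt_target_mem_nhds x
  have hψ : Filter.Tendsto (extChartAt I x).symm (nhds (extChartAt I x x)) (nhds x) := by
    simpa only [hx] using (continuousAt_extChartAt_symm (I := I) x).tendsto
  refine congrArg (fun L : E →L[ℝ] W => L _) (Filter.EventuallyEq.fderiv_eq ?_)
  filter_upwards [htarget, hψ.eventually hg] with q hq hgq
  exact (fderiv_comp_extChartAt_symm_mpullback hq hgq Y).symm

open VectorField in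
theorem mvfderiv_mlieBracket [I.Boundaryless] [CompleteSpace E] [IsManifold I 3 M]
    {g : M → W} {X Y : ∀ y : M, TangentSpace I y} {x : M} (hg : ContMDiffAt I 𝓘(ℝ, W) 2 g x)
    (hX : MDifferentiableAt I I.tangent (fun y => (⟨y, X y⟩ : TangentBundle I M)) x)
    (hY : MDifferentiableAt I I.tangent (fun y => (⟨y, Y y⟩ : TangentBundle I M)) x)
    (hXg : MDifferentiableAt I 𝓘(ℝ, W) (fun y => mvfderiv I g y (X y)) x)
    (hYg : MDifferentiableAt I 𝓘(ℝ, W) (fun y => mvfderiv I g y (Y y)) x) :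
    mvfderiv I g x (mlieBracket I X Y x)
      = mvfderiv I (fun y => mvfderiv I g y (Y y)) x (X x)
        - mvfderiv I (fun y => mvfderiv I g y (X y)) x (Y x) := by
  have : IsManifold I 2 M := .of_le (n := 3) (by norm_cast)
  have : IsManifold I 1 M := .of_le (n := 2) (by norm_num)
  have hx : (extChartAt I x).symm (extChartAt I x x) = x := extChartAt_to_inv x
  have hxt := mem_extChartAt_target (I := I) x
  have hψ := contMDiffWithinAt_extChartAt_symm_range (I := I) (n := 2) x hxt
  rw [I.range_eq_univ, contMDiffWithinAt_univ] at hψ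
  have hgψ : ContDiffAt ℝ 2 (g ∘ (extChartAt I x).symm) (extChartAt I x x) :=
    (ContMDiffAt.comp _ (hx.symm ▸ hg) hψ).contDiffAt
  have hgd : ∀ᶠ y in nhds x, MDifferentiableAt I 𝓘(ℝ, W) g y :=
    ((contMDiffAt_iff_contMDiffAt_nhds (by simp)).1 hg).mono
      fun y hy => hy.mdifferentiableAt (by simp)
  have hbracket := fderiv_comp_extChartAt_symm_mpullback hxt
    (by rw [hx]; exact hgd.self_of_nhds) (mlieBracket I X Y)
  rw [hx] at hbracket
  rw [mvfderiv_mvfderiv_eq_fderiv_fderiv hgd hYg, mvfderiv_mvfderiv_eq_fderiv_fderiv hgd hXg,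
    ← hbracket, mpullback_extChartAt_symm_mlieBracket hX hY]
  exact fderiv_apply_lieBracket hgψ (by simp) (differentiableAt_mpullback_extChartAt_symm hY)
    (differentiableAt_mpullback_extChartAt_symm hX)

theorem mvfderiv_clm_apply (L : W₁ →L[ℝ] W) {g : M → W₁} {x : M}
    (hg : MDifferentiableAt I 𝓘(ℝ, W₁) g x) (v : TangentSpace I x) :
    mvfderiv I (fun y => L (g y)) x v = L (mvfderiv I g x v) :=
  congrArg (fun A => A v) (L.hasMFDerivAt.comp x hg.hasMFDerivAt).mfderiv

theorem mvfderiv_bilinear_apply (β : W₁ →L[ℝ] W₂ →L[ℝ] W) {g : M → W₁} {h : M → W₂} {x : M}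
    (hg : MDifferentiableAt I 𝓘(ℝ, W₁) g x) (hh : MDifferentiableAt I 𝓘(ℝ, W₂) h x)
    (v : TangentSpace I x) :
    mvfderiv I (fun y => β (g y) (h y)) x v
      = β (mvfderiv I g x v) (h x) + β (g x) (mvfderiv I h x v) := by
  have hβ := (β.isBoundedBilinearMap.hasFDerivAt (g x, h x)).hasMFDerivAt
  have hgh := HasMFDerivAt.comp (I' := 𝓘(ℝ, W₁ × W₂)) x hβ
    ⟨hg.hasMFDerivAt.1.prodMk hh.hasMFDerivAt.1, hg.hasMFDerivAt.2.prodMk hh.hasMFDerivAt.2⟩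
  rw [add_comm]
  exact congrArg (fun A => A v) hgh.mfderiv

/-- `dη (X, Y) = X (η Y) - Y (η X) - η [X, Y]`, for a vector-valued one-form `η` and vector
fields `X`, `Y`. -/
def extDer (η : ∀ x : M, TangentSpace I x →ₗ[ℝ] W) (X Y : ∀ x : M, TangentSpace I x) (x : M) : W :=
  mvfderiv I (fun y => η y (Y y)) x (X x) - mvfderiv I (fun y => η y (X y)) x (Y x)
    - η x (VectorField.mlieBracket I X Y x)

variable {η : ∀ x : M, TangentSpace I x →ₗ[ℝ] W} {X X' Y Y' : ∀ x : M, TangentSpace I x} {x : M}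

theorem extDer_congr (hX : ∀ᶠ y in nhds x, X' y = X y) (hY : ∀ᶠ y in nhds x, Y' y = Y y) :
    extDer η X' Y' x = extDer η X Y x := by
  have hηX : (fun y => η y (X' y)) =ᶠ[nhds x] fun y => η y (X y) :=
    hX.mono fun y hy => by simp only [hy]
  have hηY : (fun y => η y (Y' y)) =ᶠ[nhds x] fun y => η y (Y y) :=
    hY.mono fun y hy => by simp only [hy]
  simp only [extDer, mvfderiv, hηX.mfderiv_eq, hηY.mfderiv_eq,
    Filter.EventuallyEq.mlieBracket_vectorField_eq hX hY, hX.self_of_nhds, hY.self_of_nhds]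
  rfl

theorem extDer_congr_form {η' : ∀ x : M, TangentSpace I x →ₗ[ℝ] W}
    (hη : ∀ᶠ y in nhds x, η' y = η y) : extDer η' X Y x = extDer η X Y x := by
  have hηZ (Z : ∀ x : M, TangentSpace I x) :
      (fun y => η' y (Z y)) =ᶠ[nhds x] fun y => η y (Z y) :=
    hη.mono fun y hy => congrArg (· (Z y)) hy
  simp only [extDer, mvfderiv, (hηZ _).mfderiv_eq, hη.self_of_nhds]
  rfl

theorem extDer_zero : extDer (fun y : M => (0 : TangentSpace I y →ₗ[ℝ] W)) X Y x = 0 := by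
  simp only [extDer, LinearMap.zero_apply, mvfderiv, mfderiv_const]
  exact (sub_zero _).trans (sub_zero _)

theorem extDer_swap : extDer η Y X x = -extDer η X Y x := by
  rw [extDer, extDer, VectorField.mlieBracket_swap_apply, map_neg]
  abel

theorem extDer_self : extDer η X X x = 0 := by
  simp [extDer]

theorem extDer_add_left [CompleteSpace E] [IsManifold I 2 M]
    (hX : MDifferentiableAt I I.tangent (fun y => (⟨y, X y⟩ : TangentBundle I M)) x)
    (hX' : MDifferentiableAt I I.tangent (fun y => (⟨y, X' y⟩ : TangentBundle I M)) x)
    (hηX : MDifferentiableAt I 𝓘(ℝ, W) (fun y => η y (X y)) x)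
    (hηX' : MDifferentiableAt I 𝓘(ℝ, W) (fun y => η y (X' y)) x) :
    extDer η (X + X') Y x = extDer η X Y x + extDer η X' Y x := by
  simp only [extDer, VectorField.mlieBracket_add_left hX hX', Pi.add_apply, map_add,
    mvfderiv_fun_add hηX hηX', add_apply]
  abel

theorem extDer_smul_left [CompleteSpace E] [IsManifold I 2 M] {a : M → ℝ}
    (ha : MDifferentiableAt I 𝓘(ℝ, ℝ) a x)
    (hX : MDifferentiableAt I I.tangent (fun y => (⟨y, X y⟩ : TangentBundle I M)) x)
    (hηX : MDifferentiableAt I 𝓘(ℝ, W) (fun y => η y (X y)) x) :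
    extDer η (a • X) Y x = a x • extDer η X Y x := by
  simp only [extDer, VectorField.mlieBracket_smul_left ha hX, Pi.smul_apply', map_smul, map_add,
    mvfderiv_fun_smul ha hηX, add_apply, smul_apply, ContinuousLinearMap.smulRight_apply]
  module

theorem extDer_combination [CompleteSpace E] [IsManifold I 2 M] {a b c d : M → ℝ}
    (ha : MDifferentiableAt I 𝓘(ℝ, ℝ) a x) (hb : MDifferentiableAt I 𝓘(ℝ, ℝ) b x)
    (hc : MDifferentiableAt I 𝓘(ℝ, ℝ) c x) (hd : MDifferentiableAt I 𝓘(ℝ, ℝ) d x)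
    (hX : MDifferentiableAt I I.tangent (fun y => (⟨y, X y⟩ : TangentBundle I M)) x)
    (hY : MDifferentiableAt I I.tangent (fun y => (⟨y, Y y⟩ : TangentBundle I M)) x)
    (hηX : MDifferentiableAt I 𝓘(ℝ, W) (fun y => η y (X y)) x)
    (hηY : MDifferentiableAt I 𝓘(ℝ, W) (fun y => η y (Y y)) x) :
    extDer η (a • X + b • Y) (c • X + d • Y) x = (a x * d x - b x * c x) • extDer η X Y x := by
  have : IsManifold I 1 M := .of_le (n := 2) (by norm_num)
  have hleft {a b : M → ℝ} (ha : MDifferentiableAt I 𝓘(ℝ, ℝ) a x)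
      (hb : MDifferentiableAt I 𝓘(ℝ, ℝ) b x) (Z : ∀ x : M, TangentSpace I x) :
      extDer η (a • X + b • Y) Z x = a x • extDer η X Z x + b x • extDer η Y Z x := by
    rw [extDer_add_left (ha.smul_section hX) (hb.smul_section hY)
      (by simpa only [Pi.smul_apply', map_smul, Pi.smul_def'] using ha.smul hηX)
      (by simpa only [Pi.smul_apply', map_smul, Pi.smul_def'] using hb.smul hηY),
      extDer_smul_left ha hX hηX, extDer_smul_left hb hY hηY]
  rw [hleft ha hb, extDer_swap (Y := X), extDer_swap (Y := Y), hleft hc hd, hleft hc hd,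
    extDer_self, extDer_self, extDer_swap (Y := Y) (X := X)]
  module

theorem extDer_clm_comp (L : W →L[ℝ] W₁) (hηX : MDifferentiableAt I 𝓘(ℝ, W) (fun y => η y (X y)) x)
    (hηY : MDifferentiableAt I 𝓘(ℝ, W) (fun y => η y (Y y)) x) :
    extDer (fun y => (L : W →ₗ[ℝ] W₁) ∘ₗ η y) X Y x = L (extDer η X Y x) := by
  simp only [extDer, LinearMap.comp_apply, ContinuousLinearMap.coe_coe, map_sub,
    mvfderiv_clm_apply L hηX, mvfderiv_clm_apply L hηY]

theorem extDer_bilinear (β : W₁ →L[ℝ] W →L[ℝ] W₂) {g : M → W₁}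
    (hg : MDifferentiableAt I 𝓘(ℝ, W₁) g x)
    (hηX : MDifferentiableAt I 𝓘(ℝ, W) (fun y => η y (X y)) x)
    (hηY : MDifferentiableAt I 𝓘(ℝ, W) (fun y => η y (Y y)) x) :
    extDer (fun y => (β (g y) : W →ₗ[ℝ] W₂) ∘ₗ η y) X Y x
      = β (mvfderiv I g x (X x)) (η x (Y x)) - β (mvfderiv I g x (Y x)) (η x (X x))
        + β (g x) (extDer η X Y x) := by
  simp only [extDer, LinearMap.comp_apply, ContinuousLinearMap.coe_coe, map_sub,
    mvfderiv_bilinear_apply β hg hηX, mvfderiv_bilinear_apply β hg hηY]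
  abel

theorem clm_extDer_eq_zero (L : W →L[ℝ] W₁) (hL : ∀ y v, L (η y v) = 0)
    (hηX : MDifferentiableAt I 𝓘(ℝ, W) (fun y => η y (X y)) x)
    (hηY : MDifferentiableAt I 𝓘(ℝ, W) (fun y => η y (Y y)) x) : L (extDer η X Y x) = 0 := by
  have hLη : (fun y => (L : W →ₗ[ℝ] W₁) ∘ₗ η y) = fun _ => 0 :=
    funext fun y => LinearMap.ext (hL y)
  rw [← extDer_clm_comp L hηX hηY, hLη, extDer_zero]

theorem bilinear_extDer_of_eventually_eq_zero (β : W₁ →L[ℝ] W →L[ℝ] W₂) {g : M → W₁}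
    (hβ : ∀ᶠ y in nhds x, ∀ v, β (g y) (η y v) = 0) (hg : MDifferentiableAt I 𝓘(ℝ, W₁) g x)
    (hηX : MDifferentiableAt I 𝓘(ℝ, W) (fun y => η y (X y)) x)
    (hηY : MDifferentiableAt I 𝓘(ℝ, W) (fun y => η y (Y y)) x) :
    β (g x) (extDer η X Y x)
      = β (mvfderiv I g x (Y x)) (η x (X x)) - β (mvfderiv I g x (X x)) (η x (Y x)) := by
  have hβη : ∀ᶠ y in nhds x, (β (g y) : W →ₗ[ℝ] W₂) ∘ₗ η y = 0 :=
    hβ.mono fun y hy => LinearMap.ext hy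
  have hzero := extDer_congr_form (X := X) (Y := Y) hβη
  rw [extDer_zero, extDer_bilinear β hg hηX hηY] at hzero
  rw [eq_neg_of_add_eq_zero_right hzero, neg_sub]

theorem extDer_mvfderiv_eq_zero [I.Boundaryless] [CompleteSpace E] [IsManifold I 3 M]
    {g : M → W} (hg : ContMDiffAt I 𝓘(ℝ, W) 2 g x)
    (hX : MDifferentiableAt I I.tangent (fun y => (⟨y, X y⟩ : TangentBundle I M)) x)
    (hY : MDifferentiableAt I I.tangent (fun y => (⟨y, Y y⟩ : TangentBundle I M)) x)
    (hXg : MDifferentiableAt I 𝓘(ℝ, W) (fun y => mvfderiv I g y (X y)) x)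
    (hYg : MDifferentiableAt I 𝓘(ℝ, W) (fun y => mvfderiv I g y (Y y)) x) :
    extDer (fun y => (mvfderiv I g y).toLinearMap) X Y x = 0 :=
  sub_eq_zero.2 (mvfderiv_mlieBracket hg hX hY hXg hYg).symm

end Manifold

/-! ### Linear algebra -/

section Plane

variable {T W : Type*} [AddCommGroup T] [Module ℝ T] [AddCommGroup W] [Module ℝ W]
  {o : Orientation ℝ T (Fin 2)} {X Y : T}

theorem PositiveBasis.exists_eq (h : PositiveBasis o X Y) (Z : T) :
    ∃ a b : ℝ, Z = a • X + b • Y := by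
  obtain ⟨b, rfl, rfl, -⟩ := h
  exact ⟨b.repr Z 0, b.repr Z 1, by rw [← Fin.sum_univ_two fun i => b.repr Z i • b i, b.sum_repr]⟩

theorem PositiveBasis.ne_zero_left (h : PositiveBasis o X Y) : X ≠ 0 := by
  obtain ⟨b, rfl, rfl, -⟩ := h
  exact b.ne_zero 0

theorem PositiveBasis.ne_zero_right (h : PositiveBasis o X Y) : Y ≠ 0 := by
  obtain ⟨b, rfl, rfl, -⟩ := h
  exact b.ne_zero 1

theorem PositiveBasis.det_pos (h : PositiveBasis o X Y) {a b c d : ℝ}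
    (h' : PositiveBasis o (a • X + b • Y) (c • X + d • Y)) : 0 < a * d - b * c := by
  obtain ⟨e, rfl, rfl, he⟩ := h
  obtain ⟨e', h0, h1, he'⟩ := h'
  have hdet := (e.orientation_eq_iff_det_pos e').1 (he.trans he'.symm)
  rw [Module.Basis.det_apply, Matrix.det_fin_two] at hdet
  simp only [Module.Basis.toMatrix_apply, h0, h1, map_add, map_smul, Finsupp.add_apply,
    Finsupp.smul_apply, Module.Basis.repr_self, smul_eq_mul] at hdet
  simpa [mul_comm] using hdet

theorem PositiveBasis.of_det_pos (h : PositiveBasis o X Y) {a b c d : ℝ}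
    (hd : 0 < a * d - b * c) : PositiveBasis o (a • X + b • Y) (c • X + d • Y) := by
  obtain ⟨e, rfl, rfl, rfl⟩ := h
  let v : Fin 2 → T := ![a • e 0 + b • e 1, c • e 0 + d • e 1]
  have hdet : e.det v = a * d - b * c := by
    rw [Module.Basis.det_apply, Matrix.det_fin_two]
    simp only [v, Module.Basis.toMatrix_apply, map_add, map_smul, Finsupp.add_apply,
      Finsupp.smul_apply, smul_eq_mul, Matrix.cons_val_zero, Matrix.cons_val_one,
      Module.Basis.repr_self]
    simp [mul_comm]
  have hv := (e.is_basis_iff_det (v := v)).2 (hdet ▸ hd.ne'.isUnit)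
  refine ⟨Module.Basis.mk hv.1 hv.2.ge, by simp [v], by simp [v], ?_⟩
  rw [eq_comm, Module.Basis.orientation_eq_iff_det_pos, Module.Basis.coe_mk, hdet]
  exact hd

theorem PositiveBasis.apply_comm (h : PositiveBasis o X Y) {B : T →ₗ[ℝ] T →ₗ[ℝ] W}
    (hB : B X Y = B Y X) (Z Z' : T) : B Z Z' = B Z' Z := by
  obtain ⟨a, b, rfl⟩ := h.exists_eq Z
  obtain ⟨c, d, rfl⟩ := h.exists_eq Z'
  simp only [map_add, map_smul, LinearMap.add_apply, LinearMap.smul_apply, hB]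
  module

theorem raise_comm_iff [FiniteDimensional ℝ T] {g b s : LinearMap.BilinForm ℝ T}
    (hg : g.Nondegenerate) (hgsymm : ∀ v w, g v w = g w v) (hb : ∀ v w, b v w = b w v)
    (hs : ∀ v w, s v w = s w v) :
    raise g b ∘ₗ raise g s = raise g s ∘ₗ raise g b ↔
      ∀ v w, s v (raise g b w) = s w (raise g b v) := by
  have hbs (v w : T) : g (raise g b (raise g s v)) w = s v (raise g b w) := by
    rw [raise_spec _ _ hg, hb, ← raise_spec g b hg, hgsymm, raise_spec _ _ hg]
  have hsb (v w : T) : g (raise g s (raise g b v)) w = s w (raise g b v) := by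
    rw [raise_spec _ _ hg, hs]
  refine ⟨fun h v w => ?_, fun h => LinearMap.ext fun v => sub_eq_zero.1 (hg.1 _ fun w => ?_)⟩
  · rw [← hbs, ← hsb]
    exact congrArg (g · w) (LinearMap.congr_fun h v)
  · rw [map_sub, LinearMap.sub_apply, LinearMap.comp_apply, LinearMap.comp_apply, hbs, hsb, h,
      sub_self]

end Plane

section Orthogonal

variable {V ι : Type*} [NormedAddCommGroup V] [InnerProductSpace ℝ V] [Fintype ι]

theorem exists_ne_zero_inner_eq_zero {v : ι → V} (hv : Fintype.card ι < Module.finrank ℝ V) :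
    ∃ e ≠ 0, ∀ i, inner ℝ (v i) e = 0 := by
  have : FiniteDimensional ℝ V := .of_finrank_pos (by omega)
  have hspan : Submodule.span ℝ (Set.range v) ≠ ⊤ := fun h => by
    have hle := finrank_range_le_card (R := ℝ) v
    rw [Set.finrank, h, finrank_top] at hle
    omega
  obtain ⟨e, he, he0⟩ := Submodule.exists_mem_ne_zero_of_ne_bot
    (mt Submodule.orthogonal_eq_bot_iff.1 hspan)
  exact ⟨e, he0, fun i => he _ (Submodule.subset_span ⟨i, rfl⟩)⟩

theorem eq_zero_of_inner_eq_zero {v : ι → V} (hv : Fintype.card ι + 1 = Module.finrank ℝ V)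
    (hne : ∀ i, v i ≠ 0) (horth : Pairwise fun i j => inner ℝ (v i) (v j) = 0) {n z : V}
    (hn : n ≠ 0) (hvn : ∀ i, inner ℝ (v i) n = 0) (hvz : ∀ i, inner ℝ (v i) z = 0)
    (hnz : inner ℝ n z = 0) : z = 0 := by
  have : FiniteDimensional ℝ V := .of_finrank_pos (by omega)
  let K := Submodule.span ℝ (Set.range v)
  have hK : Module.finrank ℝ Kᗮ = 1 := by
    have hindep := linearIndependent_of_ne_zero_of_inner_eq_zero hne horth
    have hsum := K.finrank_add_finrank_orthogonal
    rw [finrank_span_eq_card hindep] at hsum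
    omega
  have hmem {y : V} (hy : ∀ i, inner ℝ (v i) y = 0) : y ∈ Kᗮ := by
    refine (Submodule.isOrtho_span (s := Set.range v) (t := {y})).2 ?_ |>.ge
      (Submodule.mem_span_singleton_self y)
    rintro _ ⟨i, rfl⟩ _ rfl
    exact hy i
  obtain ⟨c, hc⟩ := (finrank_eq_one_iff_of_nonzero' ⟨n, hmem hvn⟩
    (by simpa [Subtype.ext_iff] using hn)).1 hK ⟨z, hmem hvz⟩
  obtain rfl : c • n = z := congrArg Subtype.val hc
  rw [real_inner_smul_right, mul_eq_zero, inner_self_eq_zero] at hnz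
  rw [hnz.resolve_right hn, zero_smul]

/-- The component of `e` that is orthogonal to the vectors of a pairwise orthogonal family `v`. -/
def rejection (v : ι → V) (e : V) : V := e - ∑ i, (inner ℝ (v i) e / inner ℝ (v i) (v i)) • v i

theorem inner_rejection {v : ι → V} (horth : Pairwise fun i j => inner ℝ (v i) (v j) = 0) (e : V)
    (j : ι) : inner ℝ (v j) (rejection v e) = 0 := by
  rw [rejection, inner_sub_right, inner_sum, Finset.sum_eq_single j, real_inner_smul_right,
    div_mul_cancel_of_imp, sub_self]
  · intro h
    rw [inner_self_eq_zero.1 h, inner_zero_left]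
  · intro i _ hij
    rw [real_inner_smul_right, horth hij.symm, mul_zero]
  · simp

theorem rejection_eq_self {v : ι → V} {e : V} (he : ∀ i, inner ℝ (v i) e = 0) :
    rejection v e = e := by
  simp [rejection, he]

variable {E H M : Type*} [NormedAddCommGroup E] [NormedSpace ℝ E] [TopologicalSpace H]
  {I : ModelWithCorners ℝ E H} [TopologicalSpace M] [ChartedSpace H M] {n : ℕ∞ω} {U : Set M}

theorem contMDiffOn_inner {g h : M → V} (hg : ContMDiffOn I 𝓘(ℝ, V) n g U)
    (hh : ContMDiffOn I 𝓘(ℝ, V) n h U) : ContMDiffOn I 𝓘(ℝ) n (fun y => inner ℝ (g y) (h y)) U :=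
  ((innerSL ℝ).contMDiff.comp_contMDiffOn hg).clm_apply hh

theorem contMDiffOn_rejection {v : ι → M → V} (hv : ∀ i, ContMDiffOn I 𝓘(ℝ, V) n (v i) U)
    (hne : ∀ y ∈ U, ∀ i, v i y ≠ 0) (e : V) :
    ContMDiffOn I 𝓘(ℝ, V) n (fun y => rejection (v · y) e) U := by
  refine contMDiffOn_const.sub (contMDiffOn_finsetSum fun i _ => ?_)
  exact ((contMDiffOn_inner (hv i) contMDiffOn_const).div₀ (contMDiffOn_inner (hv i) (hv i))
    fun y hy => inner_self_ne_zero.2 (hne y hy i)).smul (hv i)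

theorem exists_contMDiffOn_unit_orthogonal {v : ι → M → V} {x : M} (hU : IsOpen U) (hx : x ∈ U)
    (hv : ∀ i, ContMDiffOn I 𝓘(ℝ, V) n (v i) U) (hne : ∀ y ∈ U, ∀ i, v i y ≠ 0)
    (horth : ∀ y ∈ U, Pairwise fun i j => inner ℝ (v i y) (v j y) = 0)
    (hcard : Fintype.card ι < Module.finrank ℝ V) :
    ∃ (U' : Set M) (N : M → V), IsOpen U' ∧ x ∈ U' ∧ U' ⊆ U ∧ ContMDiffOn I 𝓘(ℝ, V) n N U' ∧
      ∀ y ∈ U', ‖N y‖ = 1 ∧ ∀ i, inner ℝ (v i y) (N y) = 0 := by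
  obtain ⟨e, he, hve⟩ := exists_ne_zero_inner_eq_zero (v := (v · x)) hcard
  let r : M → V := fun y => rejection (v · y) e
  have hr : ContMDiffOn I 𝓘(ℝ, V) n r U := contMDiffOn_rejection hv hne e
  have hnorm : ContMDiffOn I 𝓘(ℝ) n (fun y => ‖r y‖) (U ∩ r ⁻¹' {0}ᶜ) := fun y hy =>
    (contDiffAt_norm ℝ hy.2).contMDiffAt.comp_contMDiffWithinAt y
      ((hr y hy.1).mono Set.inter_subset_left)
  refine ⟨U ∩ r ⁻¹' {0}ᶜ, fun y => ‖r y‖⁻¹ • r y,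
    hr.continuousOn.isOpen_inter_preimage hU isOpen_compl_singleton,
    ⟨hx, by simpa [r, rejection_eq_self hve] using he⟩, Set.inter_subset_left,
    (hnorm.inv₀ fun y hy => norm_ne_zero_iff.2 hy.2).smul (hr.mono Set.inter_subset_left),
    fun y hy => ⟨norm_smul_inv_norm hy.2, fun i => ?_⟩⟩
  rw [real_inner_smul_right, inner_rejection (horth y hy.1), mul_zero]

end Orthogonal

section Minkowski

theorem mink_of_snd_eq_zero {u : R41} (hu : u.2 = 0) (v : R41) : mink u v = inner ℝ u.1 v.1 := by
  rw [mink_apply, hu, zero_mul, sub_zero]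

theorem mink_self_pos {v : R41} (hv : v.2 = 0) (hv0 : v ≠ 0) : 0 < mink v v := by
  rw [mink_of_snd_eq_zero hv]
  exact real_inner_self_pos.2 fun h => hv0 (Prod.ext h hv)

/-- The time-like unit vector `t₀`. -/
def t0 : R41 := (0, 1)

theorem mink_t0 (v : R41) : mink v t0 = -v.2 := by
  simp [mink_apply, t0]

theorem wedge_apply (u v w : R41) : (wedge u v).1 w = mink u w • v - mink v w • u := rfl

theorem so41_ext {A B : so41} (h : ∀ w, A.1 w = B.1 w) : A = B :=
  Subtype.ext (ContinuousLinearMap.ext h)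

theorem wedge_smul_left (c : ℝ) (u v : R41) : wedge (c • u) v = c • wedge u v :=
  so41_ext fun w => by
    simp only [Submodule.coe_smul, smul_apply, wedge_apply, map_smul, LinearMap.smul_apply,
      smul_eq_mul]
    module

theorem wedge_self (u : R41) : wedge u u = 0 := so41_ext fun _ => sub_self _

theorem wedge_apply_t0 (u v : R41) : (wedge u v).1 t0 = v.2 • u - u.2 • v := by
  rw [wedge_apply, mink_t0, mink_t0]
  module

theorem wedge_eq_wedge_iff {u w p r : R41} (huw : mink u w = 0) (huu : mink u u ≠ 0)
    (hww : mink u u = mink w w) :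
    wedge u r = wedge w p ∧ mink u r = mink w p ↔
      ∃ a b : ℝ, p = a • u + b • w ∧ r = b • u - a • w := by
  have hwu := (mink_comm w u).trans huw
  constructor
  · rintro ⟨hwedge, hmink⟩
    have hu := congrArg (·.1 u) hwedge
    have hw := congrArg (·.1 w) hwedge
    simp only [wedge_apply, huw, hwu, zero_smul, zero_sub, ← hww] at hu hw
    have hrw : mink p u = -mink r w := by
      have h := congrArg (mink u) hw
      simp only [map_neg, map_sub, map_smul, huw, smul_eq_mul, mul_zero, sub_zero] at h
      rw [mink_comm p]
      exact mul_left_cancel₀ huu (by linear_combination -h)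
    have hpw : mink p w = mink r u := by rw [mink_comm p, ← hmink, mink_comm u]
    rw [hrw, neg_smul, neg_neg] at hu
    rw [hpw] at hw
    refine ⟨-mink r w / mink u u, mink r u / mink u u, ?_, ?_⟩
    · linear_combination (norm := (match_scalars <;> field_simp <;> ring)) -(mink u u)⁻¹ • hw
    · linear_combination (norm := (match_scalars <;> field_simp <;> ring)) (mink u u)⁻¹ • hu
  · rintro ⟨a, b, rfl, rfl⟩
    refine ⟨so41_ext fun z => ?_, ?_⟩
    · rw [wedge_apply, wedge_apply]
      simp only [map_add, map_sub, map_smul, LinearMap.add_apply, LinearMap.sub_apply,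
        LinearMap.smul_apply, smul_eq_mul]
      module
    · simp [huw, hwu, hww]

instance : NormedAddCommGroup so41 := Submodule.normedAddCommGroup so41

instance : NormedSpace ℝ so41 := Submodule.normedSpace so41

instance : ContinuousConstSMul ℝ so41 := IsBoundedSMul.continuousSMul.continuousConstSMul

/-- The Minkowski inner product as a continuous bilinear map. -/
def minkL : R41 →L[ℝ] R41 →L[ℝ] ℝ := LinearMap.toContinuousBilinearMap mink

/-- The wedge product as a continuous bilinear map. -/
def wedgeL : R41 →L[ℝ] R41 →L[ℝ] so41 :=
  LinearMap.toContinuousBilinearMap <| LinearMap.mk₂ ℝ (fun u v => wedge u v)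
    (fun u u' v => so41_ext fun w => by
      simp only [Submodule.coe_add, add_apply, wedge_apply, map_add, LinearMap.add_apply]
      module)
    wedge_smul_left (fun u => (wedge u).map_add) (fun c u => (wedge u).map_smul c)

/-- Evaluation of elements of `so(4,1)` at `t₀` as a continuous linear map. -/
def evalT0 : so41 →L[ℝ] R41 := (ContinuousLinearMap.apply ℝ R41 t0).comp so41.subtypeL

theorem ProjLightCone.mem_line_iff (p : ProjLightCone) {u : R41} :
    u ∈ p.line ↔ u = u.2 • p.vec := by
  refine ⟨fun hu => ?_, fun hu => hu ▸ p.line.smul_mem _ p.vec_mem⟩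
  rw [ProjLightCone.line, Projectivization.submodule_eq, Submodule.mem_span_singleton] at hu
  obtain ⟨c, rfl⟩ := hu
  have hrep : p.1.rep.2 ≠ 0 := fun h => by
    have := p.vec_snd
    simp [ProjLightCone.vec, h] at this
  rw [ProjLightCone.vec, smul_smul, Prod.smul_snd, smul_eq_mul, mul_inv_cancel_right₀ hrep]

theorem mem_perp_line_iff {p : ProjLightCone} {v : R41} : v ∈ perp p.line ↔ mink p.vec v = 0 := by
  refine ⟨fun hv => hv _ p.vec_mem, fun hv u hu => ?_⟩
  rw [p.mem_line_iff.1 hu, map_smul, LinearMap.smul_apply, hv, smul_zero]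

theorem mem_nilradical_iff {p : ProjLightCone} {A : so41} :
    A ∈ nilradical p ↔ ∃ v : R41, v.2 = 0 ∧ mink p.vec v = 0 ∧ wedge p.vec v = A := by
  constructor
  · intro hA
    refine Submodule.span_induction ?_ ⟨0, rfl, map_zero _, map_zero _⟩ ?_ ?_ hA
    · rintro _ ⟨u, hu, v, hv, rfl⟩
      refine ⟨u.2 • (v - v.2 • p.vec), by simp [p.vec_snd], ?_, ?_⟩
      · simp [mem_perp_line_iff.1 hv, p.2 _ p.vec_mem]
      · conv_rhs => rw [p.mem_line_iff.1 hu, wedge_smul_left]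
        rw [map_smul, map_sub, map_smul, wedge_self, smul_zero, sub_zero]
    · rintro _ _ _ _ ⟨v, hv2, hv, rfl⟩ ⟨w, hw2, hw, rfl⟩
      exact ⟨v + w, by simp [hv2, hw2], by simp [hv, hw], map_add _ _ _⟩
    · rintro c _ _ ⟨v, hv2, hv, rfl⟩
      exact ⟨c • v, by simp [hv2], by simp [hv], map_smul _ _ _⟩
  · rintro ⟨v, -, hv, rfl⟩
    exact Submodule.subset_span ⟨p.vec, p.vec_mem, v, mem_perp_line_iff.2 hv, rfl⟩

end Minkowski

section Calculus

variable {M W W₁ W₂ : Type*} [TopologicalSpace M] [ChartedSpace (EuclideanSpace ℝ (Fin 2)) M]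
  [NormedAddCommGroup W] [NormedSpace ℝ W] [NormedAddCommGroup W₁] [NormedSpace ℝ W₁]
  [NormedAddCommGroup W₂] [NormedSpace ℝ W₂] {U : Set M} {x : M}

theorem SmoothOn.contMDiffAt {g : M → W} (hg : SmoothOn g U) (hU : IsOpen U) (hx : x ∈ U) :
    ContMDiffAt (𝓡 2) 𝓘(ℝ, W) ∞ g x :=
  ContMDiffOn.contMDiffAt hg (hU.mem_nhds hx)

theorem SmoothOn.mdifferentiableAt {g : M → W} (hg : SmoothOn g U) (hU : IsOpen U) (hx : x ∈ U) :
    MDifferentiableAt (𝓡 2) 𝓘(ℝ, W) g x :=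
  (hg.contMDiffAt hU hx).mdifferentiableAt (by simp)

theorem SmoothOn.bilinear (β : W₁ →L[ℝ] W₂ →L[ℝ] W) {g : M → W₁} {h : M → W₂}
    (hg : SmoothOn g U) (hh : SmoothOn h U) : SmoothOn (fun y => β (g y) (h y)) U :=
  (β.contMDiff.comp_contMDiffOn hg).clm_apply hh

variable [IsManifold (𝓡 2) ∞ M] {X Y : ∀ x : M, Tan x}

theorem SmoothField.mdifferentiableAt (hX : SmoothField X U) (hU : IsOpen U) (hx : x ∈ U) :
    MDifferentiableAt (𝓡 2) (𝓡 2).tangent (fun y => (⟨y, X y⟩ : TangentBundle (𝓡 2) M)) x :=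
  (ContMDiffOn.contMDiffAt hX (hU.mem_nhds hx)).mdifferentiableAt (by simp)

theorem SmoothField.add (hX : SmoothField X U) (hY : SmoothField Y U) : SmoothField (X + Y) U :=
  have : IsManifold (𝓡 2) (∞ + 1) M := by simpa using ‹IsManifold (𝓡 2) ∞ M›
  ContMDiffOn.add_section hX hY

theorem SmoothField.smul {a : M → ℝ} (ha : SmoothOn a U) (hX : SmoothField X U) :
    SmoothField (a • X) U :=
  have : IsManifold (𝓡 2) (∞ + 1) M := by simpa using ‹IsManifold (𝓡 2) ∞ M›
  ContMDiffOn.smul_section ha hX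

theorem SmoothOn.der {g : M → W} (hU : IsOpen U) (hg : SmoothOn g U) (hX : SmoothField X U) :
    SmoothOn (fun x => der g x (X x)) U := by
  have htangent := ContMDiffOn.contMDiffOn_tangentMapWithin (m := ∞) hg (by simp) hU.uniqueMDiffOn
  have hsnd := (contMDiff_snd_tangentBundle_modelSpace W 𝓘(ℝ, W) (n := ∞)).comp_contMDiffOn
    (htangent.comp hX fun _ hx => hx)
  refine hsnd.congr fun y hy => ?_
  change mfderiv (𝓡 2) 𝓘(ℝ, W) g y (X y) = mfderivWithin (𝓡 2) 𝓘(ℝ, W) g U y (X y)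
  rw [mfderivWithin_of_isOpen hU hy]

/-- Smoothness of a vector-valued one-form. -/
def IsSmoothForm (η : ∀ x : M, Tan x →ₗ[ℝ] W) : Prop :=
  ∀ (U : Set M) (X : ∀ x : M, Tan x), IsOpen U → SmoothField X U →
    SmoothOn (fun x => η x (X x)) U

/-- Closedness of a vector-valued one-form. -/
def IsClosedForm (η : ∀ x : M, Tan x →ₗ[ℝ] W) : Prop :=
  ∀ (U : Set M) (X Y : ∀ x : M, Tan x), IsOpen U → SmoothField X U → SmoothField Y U →
    ∀ x ∈ U, extDer η X Y x = 0

theorem IsSmoothForm.mdifferentiableAt {η : ∀ x : M, Tan x →ₗ[ℝ] W} (hη : IsSmoothForm η)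
    (hU : IsOpen U) (hX : SmoothField X U) (hx : x ∈ U) :
    MDifferentiableAt (𝓡 2) 𝓘(ℝ, W) (fun y => η y (X y)) x :=
  (hη U X hU hX).mdifferentiableAt hU hx

end Calculus

/-! ### Conformal frames and unit normals -/

section Immersion

variable {M : Type*}

theorem lift_snd (f : M → ProjLightCone) (x : M) : (lift f x).2 = 1 := (f x).vec_snd

theorem mink_lift_self (f : M → ProjLightCone) (x : M) : mink (lift f x) (lift f x) = 0 :=
  (f x).2 _ (f x).vec_mem

variable [TopologicalSpace M] [ChartedSpace (EuclideanSpace ℝ (Fin 2)) M]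
  {f : M → ProjLightCone} {x : M}

theorem IsImmersion.smoothOn (hf : IsImmersion f) (U : Set M) : SmoothOn (lift f) U :=
  hf.1.mono (Set.subset_univ _)

theorem IsImmersion.mdifferentiableAt (hf : IsImmersion f) (x : M) :
    MDifferentiableAt (𝓡 2) 𝓘(ℝ, R41) (lift f) x :=
  hf.1.mdifferentiableAt isOpen_univ (Set.mem_univ x)

theorem IsImmersion.der_snd (hf : IsImmersion f) (x : M) (v : Tan x) :
    (der (lift f) x v).2 = 0 := by
  have h := mvfderiv_clm_apply (ContinuousLinearMap.snd ℝ _ ℝ) (hf.mdifferentiableAt x) v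
  simp only [ContinuousLinearMap.coe_snd', lift_snd, mvfderiv_const] at h
  exact h.symm

theorem IsImmersion.mink_lift_der (hf : IsImmersion f) (x : M) (v : Tan x) :
    mink (lift f x) (der (lift f) x v) = 0 := by
  have h : mvfderiv (𝓡 2) (fun y => mink (lift f y) (lift f y)) x v
      = mink (der (lift f) x v) (lift f x) + mink (lift f x) (der (lift f) x v) :=
    mvfderiv_bilinear_apply minkL (hf.mdifferentiableAt x) (hf.mdifferentiableAt x) v
  simp only [mink_lift_self, mvfderiv_const] at h
  rw [mink_comm (der _ _ _), ← two_mul] at h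
  simpa using h.symm

theorem firstForm_apply (f : M → ProjLightCone) (x : M) (v w : Tan x) :
    firstForm f x v w = mink (der (lift f) x v) (der (lift f) x w) := rfl

theorem firstForm_comm (f : M → ProjLightCone) (x : M) (v w : Tan x) :
    firstForm f x v w = firstForm f x w v := mink_comm _ _

theorem IsImmersion.firstForm_pos (hf : IsImmersion f) {v : Tan x} (hv : v ≠ 0) :
    0 < firstForm f x v v :=
  mink_self_pos (hf.der_snd x v) fun h => hv (hf.2 x (h.trans (map_zero _).symm))

theorem IsImmersion.nondegenerate_firstForm (hf : IsImmersion f) (x : M) :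
    (firstForm f x).Nondegenerate := by
  refine ⟨fun v hv => ?_, fun v hv => ?_⟩ <;>
  · by_contra h
    exact (hf.firstForm_pos h).ne' (hv v)

theorem IsImmersion.smoothOn_firstForm [IsManifold (𝓡 2) ∞ M] (hf : IsImmersion f)
    {X Y : ∀ x : M, Tan x} {U : Set M} (hU : IsOpen U) (hX : SmoothField X U)
    (hY : SmoothField Y U) :
    SmoothOn (fun x => firstForm f x (X x) (Y x)) U :=
  .bilinear minkL ((hf.smoothOn U).der hU hX) ((hf.smoothOn U).der hU hY)

end Immersion

section ConformalFrame

variable {M : Type*} [TopologicalSpace M] [ChartedSpace (EuclideanSpace ℝ (Fin 2)) M]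
  [IsManifold (𝓡 2) ∞ M] {f : M → ProjLightCone} {o : SurfaceOrientation M} {x : M}

section Pair

variable {X Y : Tan x}

theorem IsConformalPair.firstForm_pos (h : IsConformalPair o f x X Y) (hf : IsImmersion f) :
    0 < firstForm f x X X :=
  hf.firstForm_pos h.1.ne_zero_left

theorem IsConformalPair.firstForm_combination (h : IsConformalPair o f x X Y) (a b c d : ℝ) :
    firstForm f x (a • X + b • Y) (c • X + d • Y) = (a * c + b * d) * firstForm f x X X := by
  simp only [map_add, map_smul, LinearMap.add_apply, LinearMap.smul_apply, smul_eq_mul,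
    firstForm_comm f x Y X, h.2.2, ← h.2.1]
  ring

theorem IsConformalPair.eq_combination (h : IsConformalPair o f x X Y) (hf : IsImmersion f)
    (Z : Tan x) : Z = (firstForm f x Z X / firstForm f x X X) • X
      + (firstForm f x Z Y / firstForm f x X X) • Y := by
  obtain ⟨a, b, rfl⟩ := h.1.exists_eq Z
  have hX := h.firstForm_combination a b 1 0
  have hY := h.firstForm_combination a b 0 1
  simp only [one_smul, zero_smul, add_zero, zero_add, mul_one, mul_zero] at hX hY
  rw [hX, hY, mul_div_cancel_right₀ _ (h.firstForm_pos hf).ne',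
    mul_div_cancel_right₀ _ (h.firstForm_pos hf).ne']

theorem IsConformalPair.rotate (h : IsConformalPair o f x X Y) {a b : ℝ}
    (hab : 0 < a * a + b * b) :
    IsConformalPair o f x (a • X + b • Y) ((-b) • X + a • Y) := by
  refine ⟨h.1.of_det_pos (by linarith), ?_, ?_⟩ <;>
  · simp only [h.firstForm_combination]
    ring

theorem IsConformalPair.exists_rotation (h : IsConformalPair o f x X Y) {X' Y' : Tan x}
    (h' : IsConformalPair o f x X' Y') (hf : IsImmersion f) :
    ∃ a b : ℝ, X' = a • X + b • Y ∧ Y' = (-b) • X + a • Y := by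
  obtain ⟨a, b, rfl⟩ := h.1.exists_eq X'
  obtain ⟨c, d, rfl⟩ := h.1.exists_eq Y'
  have hdet : 0 < a * d - b * c := h.1.det_pos h'.1
  have hl := (h.firstForm_pos hf).ne'
  have hlength : a * a + b * b = c * c + d * d :=
    mul_right_cancel₀ hl (by simpa only [h.firstForm_combination] using h'.2.1)
  have hangle : a * c + b * d = 0 := by
    simpa only [h.firstForm_combination, mul_eq_zero, hl, or_false] using h'.2.2
  have hdet_eq : a * d - b * c = a * a + b * b :=
    (pow_left_inj₀ hdet.le (add_nonneg (mul_self_nonneg a) (mul_self_nonneg b)) two_ne_zero).1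
      (by linear_combination (-(a * c + b * d)) * hangle - (a * a + b * b) * hlength)
  have hsq : (c + b) ^ 2 + (d - a) ^ 2 = 0 := by linear_combination -2 * hdet_eq - hlength
  obtain ⟨hc, hd⟩ := (add_eq_zero_iff_of_nonneg (sq_nonneg _) (sq_nonneg _)).1 hsq
  exact ⟨a, b, rfl, by rw [eq_neg_of_add_eq_zero_left (pow_eq_zero_iff two_ne_zero |>.1 hc),
    sub_eq_zero.1 (pow_eq_zero_iff two_ne_zero |>.1 hd)]⟩

end Pair

/-- The component of `Y` that is orthogonal to `X` for the induced metric. -/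
def orthogonalPart (f : M → ProjLightCone) (X Y : ∀ x : M, Tan x) : ∀ x : M, Tan x :=
  (fun x => -(firstForm f x (X x) (Y x) / firstForm f x (X x) (X x))) • X + Y

/-- The component of `Y` that is orthogonal to `X`, rescaled to the length of `X`. -/
def conformalPartner (f : M → ProjLightCone) (X Y : ∀ x : M, Tan x) : ∀ x : M, Tan x :=
  (fun x => √(firstForm f x (X x) (X x) /
    firstForm f x (orthogonalPart f X Y x) (orthogonalPart f X Y x))) • orthogonalPart f X Y

variable {U : Set M} {X Y : ∀ x : M, Tan x}

theorem PositiveBasis.positiveBasis_orthogonalPart (h : PositiveBasis (o.at_pt x) (X x) (Y x)) :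
    PositiveBasis (o.at_pt x) (X x) (orthogonalPart f X Y x) := by
  simpa [orthogonalPart] using h.of_det_pos (a := 1) (b := 0) (d := 1)
    (c := -(firstForm f x (X x) (Y x) / firstForm f x (X x) (X x))) (by simp)

theorem PositiveBasis.isConformalPair (h : PositiveBasis (o.at_pt x) (X x) (Y x))
    (hf : IsImmersion f) : IsConformalPair o f x (X x) (conformalPartner f X Y x) := by
  have hX := hf.firstForm_pos h.ne_zero_left
  have hZ := hf.firstForm_pos (h.positiveBasis_orthogonalPart (f := f)).ne_zero_right
  have hXZ : firstForm f x (X x) (orthogonalPart f X Y x) = 0 := by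
    simp [orthogonalPart, hX.ne']
  refine ⟨?_, ?_, ?_⟩
  · have hpos := Real.sqrt_pos.2 (div_pos hX hZ)
    simpa [conformalPartner] using
      h.positiveBasis_orthogonalPart.of_det_pos (a := 1) (b := 0) (c := 0) (by simpa using hpos)
  · simp only [conformalPartner, Pi.smul_apply', map_smul, LinearMap.smul_apply, smul_eq_mul]
    rw [← mul_assoc, Real.mul_self_sqrt (div_pos hX hZ).le, div_mul_cancel₀ _ hZ.ne']
  · rw [conformalPartner, Pi.smul_apply', map_smul, hXZ, smul_zero]

theorem smoothField_conformalPartner (hf : IsImmersion f) (hU : IsOpen U)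
    (hX : SmoothField X U) (hY : SmoothField Y U)
    (hXY : ∀ y ∈ U, PositiveBasis (o.at_pt y) (X y) (Y y)) :
    SmoothField (conformalPartner f X Y) U := by
  have hXX : ∀ y ∈ U, 0 < firstForm f y (X y) (X y) := fun y hy =>
    hf.firstForm_pos (hXY y hy).ne_zero_left
  have hZZ : ∀ y ∈ U, 0 < firstForm f y (orthogonalPart f X Y y) (orthogonalPart f X Y y) :=
    fun y hy => hf.firstForm_pos (hXY y hy).positiveBasis_orthogonalPart.ne_zero_right
  have hsmooth := hf.smoothOn_firstForm hU hX hX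
  have hcoeff := (hf.smoothOn_firstForm hU hX hY).div₀ hsmooth fun y hy => (hXX y hy).ne'
  have hZ : SmoothField (orthogonalPart f X Y) U := .add (.smul hcoeff.neg hX) hY
  refine .smul (fun y hy => ?_) hZ
  exact (Real.contDiffAt_sqrt (div_pos (hXX y hy) (hZZ y hy)).ne').contMDiffAt
    |>.comp_contMDiffWithinAt (f := fun y => firstForm f y (X y) (X y) /
      firstForm f y (orthogonalPart f X Y y) (orthogonalPart f X Y y)) y
      (hsmooth.div₀ (hf.smoothOn_firstForm hU hZ hZ) (fun y hy => (hZZ y hy).ne') y hy)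

/-- `X, Y` is on the open set `U` a smooth positively oriented conformal frame. -/
structure IsConformalFrame (o : SurfaceOrientation M) (f : M → ProjLightCone)
    (X Y : ∀ x : M, Tan x) (U : Set M) : Prop where
  isOpen : IsOpen U
  smooth_left : SmoothField X U
  smooth_right : SmoothField Y U
  pair : ∀ x ∈ U, IsConformalPair o f x (X x) (Y x)

theorem IsConformalFrame.mono {V : Set M} (h : IsConformalFrame o f X Y U) (hV : IsOpen V)
    (hVU : V ⊆ U) : IsConformalFrame o f X Y V :=
  ⟨hV, h.smooth_left.mono hVU, h.smooth_right.mono hVU, fun x hx => h.pair x (hVU hx)⟩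

theorem IsImmersion.exists_conformalFrame (hf : IsImmersion f) (o : SurfaceOrientation M)
    (x : M) : ∃ (U : Set M) (X Y : ∀ y : M, Tan y), x ∈ U ∧ IsConformalFrame o f X Y U := by
  obtain ⟨U, hU, hx, X, Y, hX, hY, hXY⟩ := o.exists_frame x
  exact ⟨U, X, conformalPartner f X Y, hx, hU, hX, smoothField_conformalPartner hf hU hX hY hXY,
    fun y hy => (hXY y hy).isConformalPair hf⟩

theorem IsConformalFrame.exists_coeff {Z : ∀ x : M, Tan x} (h : IsConformalFrame o f X Y U)
    (hf : IsImmersion f) (hZ : SmoothField Z U) :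
    ∃ a b : M → ℝ, SmoothOn a U ∧ SmoothOn b U ∧ ∀ y ∈ U, Z y = (a • X + b • Y) y :=
  have hXX : ∀ y ∈ U, firstForm f y (X y) (X y) ≠ 0 := fun y hy =>
    ((h.pair y hy).firstForm_pos hf).ne'
  have hsmooth := hf.smoothOn_firstForm h.isOpen h.smooth_left h.smooth_left
  ⟨_, _, (hf.smoothOn_firstForm h.isOpen hZ h.smooth_left).div₀ hsmooth hXX,
    (hf.smoothOn_firstForm h.isOpen hZ h.smooth_right).div₀ hsmooth hXX,
    fun y hy => (h.pair y hy).eq_combination hf (Z y)⟩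

theorem IsConformalFrame.extDer_eq_zero {W : Type*} [NormedAddCommGroup W] [NormedSpace ℝ W]
    {η : ∀ x : M, Tan x →ₗ[ℝ] W} (h : IsConformalFrame o f X Y U) (hf : IsImmersion f)
    (hη : IsSmoothForm η) (hx : x ∈ U) (hXY : extDer η X Y x = 0) {V : Set M}
    {Z Z' : ∀ x : M, Tan x} (hV : IsOpen V) (hZ : SmoothField Z V) (hZ' : SmoothField Z' V)
    (hxV : x ∈ V) : extDer η Z Z' x = 0 := by
  have hUV := h.isOpen.inter hV
  have hxUV : x ∈ U ∩ V := ⟨hx, hxV⟩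
  have h' := h.mono hUV Set.inter_subset_left
  obtain ⟨a, b, ha, hb, hab⟩ := h'.exists_coeff hf (hZ.mono Set.inter_subset_right)
  obtain ⟨c, d, hc, hd, hcd⟩ := h'.exists_coeff hf (hZ'.mono Set.inter_subset_right)
  have hnhds := hUV.mem_nhds hxUV
  rw [extDer_congr (Filter.eventually_of_mem hnhds hab) (Filter.eventually_of_mem hnhds hcd),
    extDer_combination (ha.mdifferentiableAt hUV hxUV) (hb.mdifferentiableAt hUV hxUV)
      (hc.mdifferentiableAt hUV hxUV) (hd.mdifferentiableAt hUV hxUV)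
      (h'.smooth_left.mdifferentiableAt hUV hxUV) (h'.smooth_right.mdifferentiableAt hUV hxUV)
      (hη.mdifferentiableAt hUV h'.smooth_left hxUV)
      (hη.mdifferentiableAt hUV h'.smooth_right hxUV), hXY, smul_zero]

end ConformalFrame

section UnitNormal

variable {M : Type*} [TopologicalSpace M] [ChartedSpace (EuclideanSpace ℝ (Fin 2)) M]
  {f : M → ProjLightCone} {U : Set M} {x : M}

theorem IsUnitNormal.mono {N : M → R41} {V : Set M} (h : IsUnitNormal f N U) (hVU : V ⊆ U) :
    IsUnitNormal f N V :=
  ⟨ContMDiffOn.mono h.smooth hVU, fun x hx => h.tangent_sphere x (hVU hx),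
    fun x hx => h.normal x (hVU hx), fun x hx => h.unit x (hVU hx)⟩

/-- The `ℝ⁴`-components of `F`, `dF X` and `dF Y`. -/
def sphereFrame (f : M → ProjLightCone) (x : M) (X Y : Tan x) : Fin 3 → EuclideanSpace ℝ (Fin 4) :=
  ![(lift f x).1, (der (lift f) x X).1, (der (lift f) x Y).1]

theorem inner_sphereFrame_eq_zero_iff {X Y : Tan x} {z : R41} (hf : IsImmersion f) (hz : z.2 = 0) :
    (∀ i, inner ℝ (sphereFrame f x X Y i) z.1 = 0) ↔
      mink (lift f x) z = 0 ∧ mink (der (lift f) x X) z = 0 ∧ mink (der (lift f) x Y) z = 0 := by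
  rw [mink_of_snd_eq_zero (hf.der_snd x X), mink_of_snd_eq_zero (hf.der_snd x Y),
    mink_comm (lift f x), mink_of_snd_eq_zero hz, real_inner_comm]
  simp [Fin.forall_fin_succ, sphereFrame]

variable [IsManifold (𝓡 2) ∞ M] {o : SurfaceOrientation M}

theorem IsConformalPair.pairwise_inner_sphereFrame {X Y : Tan x} (h : IsConformalPair o f x X Y)
    (hf : IsImmersion f) :
    Pairwise fun i j => inner ℝ (sphereFrame f x X Y i) (sphereFrame f x X Y j) = 0 := by
  have hFX (Z : Tan x) : inner ℝ (lift f x).1 (der (lift f) x Z).1 = 0 := by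
    rw [real_inner_comm, ← mink_of_snd_eq_zero (hf.der_snd x Z), mink_comm, hf.mink_lift_der]
  have hXY : inner ℝ (der (lift f) x X).1 (der (lift f) x Y).1 = 0 := by
    rw [← mink_of_snd_eq_zero (hf.der_snd x X), ← firstForm_apply, h.2.2]
  intro i j hij
  fin_cases i <;> fin_cases j <;> simp_all [sphereFrame, real_inner_comm]

theorem IsConformalPair.sphereFrame_ne_zero {X Y : Tan x} (h : IsConformalPair o f x X Y)
    (hf : IsImmersion f) (i : Fin 3) : sphereFrame f x X Y i ≠ 0 := by
  have hF : (lift f x).1 ≠ 0 := fun h0 => by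
    have hnull := mink_lift_self f x
    simp [mink_apply, h0, lift_snd] at hnull
  have hd {Z : Tan x} (hZ : Z ≠ 0) : (der (lift f) x Z).1 ≠ 0 := fun h0 =>
    hZ (hf.2 x ((Prod.ext h0 (hf.der_snd x Z)).trans (map_zero (der (lift f) x)).symm))
  fin_cases i
  exacts [hF, hd h.1.ne_zero_left, hd h.1.ne_zero_right]

theorem IsConformalFrame.exists_isUnitNormal {X Y : ∀ x : M, Tan x}
    (h : IsConformalFrame o f X Y U) (hf : IsImmersion f) (hx : x ∈ U) :
    ∃ (V : Set M) (N : M → R41), x ∈ V ∧ IsConformalFrame o f X Y V ∧ IsUnitNormal f N V := by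
  have hfst {g : M → R41} (hg : SmoothOn g U) : SmoothOn (fun y => (g y).1) U :=
    (ContinuousLinearMap.fst ℝ (EuclideanSpace ℝ (Fin 4)) ℝ).contMDiff.comp_contMDiffOn hg
  have hv (i : Fin 3) : SmoothOn (fun y => sphereFrame f y (X y) (Y y) i) U := by
    fin_cases i
    exacts [hfst (hf.smoothOn U), hfst ((hf.smoothOn U).der h.isOpen h.smooth_left),
      hfst ((hf.smoothOn U).der h.isOpen h.smooth_right)]
  obtain ⟨V, n, hV, hxV, hVU, hn, hunit⟩ := exists_contMDiffOn_unit_orthogonal h.isOpen hx hv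
    (fun y hy => (h.pair y hy).sphereFrame_ne_zero hf)
    (fun y hy => (h.pair y hy).pairwise_inner_sphereFrame hf) (by simp)
  have horth (y) (hy : y ∈ V) :=
    (inner_sphereFrame_eq_zero_iff (z := (n y, 0)) hf rfl).1 (hunit y hy).2
  refine ⟨V, fun y => (n y, 0), hxV, h.mono hV hVU,
    (ContinuousLinearMap.inl ℝ (EuclideanSpace ℝ (Fin 4)) ℝ).contMDiff.comp_contMDiffOn hn,
    fun y hy => ⟨rfl, (mink_comm _ _).trans (horth y hy).1⟩, fun y hy Z => ?_, fun y hy => ?_⟩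
  · obtain ⟨a, b, rfl⟩ := (h.pair y (hVU hy)).1.exists_eq Z
    rw [mink_comm, map_add, map_smul, map_smul, map_add, map_smul, map_smul, LinearMap.add_apply,
      LinearMap.smul_apply, LinearMap.smul_apply, (horth y hy).2.1, (horth y hy).2.2, smul_zero,
      smul_zero, add_zero]
  · simp [mink_apply, (hunit y hy).1]

theorem IsUnitNormal.eq_zero_of_mink_eq_zero {N : M → R41} (hN : IsUnitNormal f N U) (hx : x ∈ U)
    {X Y : Tan x} (h : IsConformalPair o f x X Y) (hf : IsImmersion f) {z : R41} (hz : z.2 = 0)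
    (hF : mink (lift f x) z = 0) (hX : mink (der (lift f) x X) z = 0)
    (hY : mink (der (lift f) x Y) z = 0) (hNz : mink (N x) z = 0) : z = 0 := by
  obtain ⟨hN2, hNF⟩ := hN.tangent_sphere x hx
  have hN0 : (N x).1 ≠ 0 := fun h0 => by
    have hunit := hN.unit x hx
    simp [mink_apply, h0, hN2] at hunit
  rw [mink_of_snd_eq_zero hN2] at hNz
  refine Prod.ext (eq_zero_of_inner_eq_zero (v := sphereFrame f x X Y) (by simp)
    (h.sphereFrame_ne_zero hf) (h.pairwise_inner_sphereFrame hf) hN0 ?_ ?_ hNz) hz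
  · refine (inner_sphereFrame_eq_zero_iff hf hN2).2 ⟨?_, ?_, ?_⟩ <;> rw [mink_comm]
    exacts [hNF, hN.normal x hx X, hN.normal x hx Y]
  · exact (inner_sphereFrame_eq_zero_iff hf hz).2 ⟨hF, hX, hY⟩

end UnitNormal

/-! ### One-forms with values in `f ∧ f^⊥` -/

section NilradicalForms

variable {M : Type*} [TopologicalSpace M] [ChartedSpace (EuclideanSpace ℝ (Fin 2)) M]
  {f : M → ProjLightCone}

/-- The `so(4,1)`-valued one-form `F ∧ θ`. -/
def wedgeForm (f : M → ProjLightCone) (θ : ∀ x : M, Tan x →ₗ[ℝ] R41) : OneForm M :=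
  fun x => wedge (lift f x) ∘ₗ θ x

/-- The form `θ` with `F ∧ θ = η`, for a one-form `η` with values in `f ∧ f^⊥`. It is read off
from `(F ∧ v) t₀ = -v`, for `v` orthogonal to `t₀`. -/
def vectorForm (η : OneForm M) (x : M) : Tan x →ₗ[ℝ] R41 :=
  (-evalT0).toLinearMap ∘ₗ η x

theorem OneForm.TakesValuesInNilradical.vectorForm_spec {η : OneForm M}
    (hη : η.TakesValuesInNilradical f) (x : M) (v : Tan x) :
    (vectorForm η x v).2 = 0 ∧ mink (lift f x) (vectorForm η x v) = 0 ∧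
      wedge (lift f x) (vectorForm η x v) = η x v := by
  obtain ⟨w, hw2, hw, hwη⟩ := mem_nilradical_iff.1 (hη x v)
  have hvec : vectorForm η x v = w := by
    change -((η x v).1 t0) = w
    rw [← hwη, wedge_apply_t0, hw2, ProjLightCone.vec_snd, zero_smul, zero_sub, one_smul, neg_neg]
  rw [hvec]
  exact ⟨hw2, hw, hwη⟩

theorem OneForm.TakesValuesInNilradical.wedgeForm_vectorForm {η : OneForm M}
    (hη : η.TakesValuesInNilradical f) : wedgeForm f (vectorForm η) = η :=
  funext fun x => LinearMap.ext fun v => (hη.vectorForm_spec x v).2.2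

variable [IsManifold (𝓡 2) ∞ M]

/-- In terms of conformal frames: `θ = dF ∘ A` for an endomorphism `A` of the tangent planes that is
symmetric and trace-free with respect to the induced metric. -/
def IsSymmetricTraceFree (o : SurfaceOrientation M) (f : M → ProjLightCone)
    (θ : ∀ x : M, Tan x →ₗ[ℝ] R41) : Prop :=
  ∀ (x : M) (X Y : Tan x), IsConformalPair o f x X Y → ∃ a b : ℝ,
    θ x X = a • der (lift f) x X + b • der (lift f) x Y ∧
    θ x Y = b • der (lift f) x X - a • der (lift f) x Y

/-- A smooth one-form with values in `f⁻¹ TS³`, the bundle of vectors of `ℝ⁴` orthogonal to the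
lift of `f`. -/
structure IsTangentForm (f : M → ProjLightCone) (θ : ∀ x : M, Tan x →ₗ[ℝ] R41) : Prop where
  smooth : IsSmoothForm θ
  snd : ∀ (x : M) (v : Tan x), (θ x v).2 = 0
  mink_lift : ∀ (x : M) (v : Tan x), mink (lift f x) (θ x v) = 0

theorem OneForm.IsSmooth.isTangentForm_vectorForm {η : OneForm M} (hη : η.IsSmooth)
    (hηf : η.TakesValuesInNilradical f) : IsTangentForm f (vectorForm η) where
  smooth U X hU hX := (-evalT0).contMDiff.comp_contMDiffOn (hη U X hU hX)
  snd x v := (hηf.vectorForm_spec x v).1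
  mink_lift x v := (hηf.vectorForm_spec x v).2.1

namespace IsTangentForm

variable {θ : ∀ x : M, Tan x →ₗ[ℝ] R41} {U : Set M} {X Y : ∀ x : M, Tan x} {x : M}

theorem takesValuesInNilradical_wedgeForm (hθ : IsTangentForm f θ) :
    (wedgeForm f θ).TakesValuesInNilradical f := fun x v =>
  mem_nilradical_iff.2 ⟨θ x v, hθ.snd x v, hθ.mink_lift x v, rfl⟩

theorem isSmooth_wedgeForm (hθ : IsTangentForm f θ) (hf : IsImmersion f) :
    (wedgeForm f θ).IsSmooth := fun U X hU hX =>
  (hf.smoothOn U).bilinear wedgeL (hθ.smooth U X hU hX)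

theorem extDer_snd (hθ : IsTangentForm f θ) (hU : IsOpen U) (hX : SmoothField X U)
    (hY : SmoothField Y U) (hx : x ∈ U) : (extDer θ X Y x).2 = 0 :=
  clm_extDer_eq_zero (ContinuousLinearMap.snd ℝ _ ℝ) hθ.snd
    (hθ.smooth.mdifferentiableAt hU hX hx) (hθ.smooth.mdifferentiableAt hU hY hx)

theorem mink_lift_extDer (hθ : IsTangentForm f θ) (hf : IsImmersion f) (hU : IsOpen U)
    (hX : SmoothField X U) (hY : SmoothField Y U) (hx : x ∈ U) :
    mink (lift f x) (extDer θ X Y x)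
      = mink (der (lift f) x (Y x)) (θ x (X x)) - mink (der (lift f) x (X x)) (θ x (Y x)) :=
  bilinear_extDer_of_eventually_eq_zero minkL (.of_forall hθ.mink_lift) (hf.mdifferentiableAt x)
    (hθ.smooth.mdifferentiableAt hU hX hx) (hθ.smooth.mdifferentiableAt hU hY hx)

theorem extDer_wedgeForm (hθ : IsTangentForm f θ) (hf : IsImmersion f) (hU : IsOpen U)
    (hX : SmoothField X U) (hY : SmoothField Y U) (hx : x ∈ U) :
    extDer (wedgeForm f θ) X Y x
      = wedge (der (lift f) x (X x)) (θ x (Y x)) - wedge (der (lift f) x (Y x)) (θ x (X x))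
        + wedge (lift f x) (extDer θ X Y x) :=
  extDer_bilinear wedgeL (hf.mdifferentiableAt x) (hθ.smooth.mdifferentiableAt hU hX hx)
    (hθ.smooth.mdifferentiableAt hU hY hx)

theorem extDer_wedgeForm_eq_zero_iff (hθ : IsTangentForm f θ) (hf : IsImmersion f) (hU : IsOpen U)
    (hX : SmoothField X U) (hY : SmoothField Y U) (hx : x ∈ U) :
    extDer (wedgeForm f θ) X Y x = 0 ↔ extDer θ X Y x = 0 ∧
      wedge (der (lift f) x (X x)) (θ x (Y x)) = wedge (der (lift f) x (Y x)) (θ x (X x)) := by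
  rw [hθ.extDer_wedgeForm hf hU hX hY hx]
  constructor
  · intro h
    have h0 : extDer θ X Y x = 0 := by
      have ht0 := congrArg (fun A : so41 => A.1 t0) h
      simpa [wedge_apply_t0, hf.der_snd, hθ.snd, hθ.extDer_snd hU hX hY hx, lift_snd] using ht0
    rw [h0, map_zero, add_zero, sub_eq_zero] at h
    exact ⟨h0, h⟩
  · rintro ⟨h0, h⟩
    rw [h0, h, map_zero, add_zero, sub_self]

theorem isClosed_wedgeForm_iff (hθ : IsTangentForm f θ) (o : SurfaceOrientation M)
    (hf : IsImmersion f) : (wedgeForm f θ).IsClosed ↔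
      IsClosedForm θ ∧ IsSymmetricTraceFree o f θ := by
  have hiff {x : M} {X Y : Tan x} (h : IsConformalPair o f x X Y) :=
    wedge_eq_wedge_iff (r := θ x Y) (p := θ x X) h.2.2 (h.firstForm_pos hf).ne' h.2.1
  constructor
  · intro hclosed
    have hθclosed : IsClosedForm θ := fun U X Y hU hX hY x hx =>
      ((hθ.extDer_wedgeForm_eq_zero_iff hf hU hX hY hx).1 (hclosed U X Y hU hX hY x hx)).1
    refine ⟨hθclosed, fun x X Y hXY => (hiff hXY).1 ?_⟩
    obtain ⟨U, X', Y', hx, hU, hX', hY', hXY'⟩ := hf.exists_conformalFrame o x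
    have hbasis := (hXY' x hx).1
    refine ⟨hbasis.apply_comm (B := wedgeL.toLinearMap₁₂.compl₁₂ (der (lift f) x) (θ x)) ?_ X Y,
      hbasis.apply_comm (B := mink.compl₁₂ (der (lift f) x) (θ x)) ?_ X Y⟩
    · exact ((hθ.extDer_wedgeForm_eq_zero_iff hf hU hX' hY' hx).1
        (hclosed U X' Y' hU hX' hY' x hx)).2
    · have h := hθ.mink_lift_extDer hf hU hX' hY' hx
      rw [hθclosed U X' Y' hU hX' hY' x hx, map_zero] at h
      exact (sub_eq_zero.1 h.symm).symm
  · rintro ⟨hθclosed, hab⟩ U X Y hU hX hY x hx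
    refine (hθ.extDer_wedgeForm_eq_zero_iff hf hU hX hY hx).2
      ⟨hθclosed U X Y hU hX hY x hx, ?_⟩
    obtain ⟨_, X', Y', hx', h⟩ := hf.exists_conformalFrame o x
    exact (h.pair x hx').1.apply_comm
      (B := wedgeL.toLinearMap₁₂.compl₁₂ (der (lift f) x) (θ x))
      ((hiff (h.pair x hx')).2 (hab x _ _ (h.pair x hx'))).1 _ _

end IsTangentForm

end NilradicalForms

section TangentForm

variable {M : Type*} [TopologicalSpace M] [ChartedSpace (EuclideanSpace ℝ (Fin 2)) M]
  {f : M → ProjLightCone} {q : BilinField M}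

theorem realForm_apply (q : BilinField M) (x : M) (v w : Tan x) :
    realForm q x v w = 2 * (q x v w).re := rfl

theorem firstForm_quadEnd (hf : IsImmersion f) (q : BilinField M) (x : M) (v w : Tan x) :
    firstForm f x (quadEnd f q x v) w = 2 * (q x v w).re := by
  rw [quadEnd, raise_spec _ _ (hf.nondegenerate_firstForm x), realForm_apply]

/-- The one-form `-(1/6) dF ∘ Q`, for which `η_q = F ∧ tangentForm f q`. -/
def tangentForm (f : M → ProjLightCone) (q : BilinField M) (x : M) : Tan x →ₗ[ℝ] R41 :=
  (-(1 / 6 : ℝ)) • (der (lift f) x ∘ₗ quadEnd f q x)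

theorem tangentForm_apply (f : M → ProjLightCone) (q : BilinField M) (x : M) (v : Tan x) :
    tangentForm f q x v = (-(1 / 6 : ℝ)) • der (lift f) x (quadEnd f q x v) := rfl

theorem wedgeForm_tangentForm (f : M → ProjLightCone) (q : BilinField M) :
    wedgeForm f (tangentForm f q) = associatedForm f q := rfl

theorem mink_tangentForm (hf : IsImmersion f) (q : BilinField M) (x : M) (v w : Tan x) :
    mink (tangentForm f q x v) (der (lift f) x w) = -(1 / 3) * (q x v w).re := by
  rw [tangentForm_apply, map_smul, LinearMap.smul_apply, ← firstForm_apply, firstForm_quadEnd hf,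
    smul_eq_mul]
  ring

variable [IsManifold (𝓡 2) ∞ M] {o : SurfaceOrientation M}

namespace IsQuadraticDifferential

theorem apply_right (hq : IsQuadraticDifferential o f q) {x : M} {X Y : Tan x}
    (h : IsConformalPair o f x X Y) (Z : Tan x) : q x Z Y = Complex.I * q x Z X := by
  rw [hq.symm, hq.type_two_zero x X Y h, hq.symm]

theorem apply_right_right (hq : IsQuadraticDifferential o f q) {x : M} {X Y : Tan x}
    (h : IsConformalPair o f x X Y) : q x Y Y = -q x X X := by
  rw [hq.type_two_zero x X Y h, hq.apply_right h, ← mul_assoc, Complex.I_mul_I, neg_one_mul]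

theorem isSymmetricTraceFree_tangentForm (hq : IsQuadraticDifferential o f q)
    (hf : IsImmersion f) : IsSymmetricTraceFree o f (tangentForm f q) := fun x X Y h => by
  refine ⟨-(1 / 6) * (2 * (q x X X).re / firstForm f x X X),
    -(1 / 6) * (2 * (q x X Y).re / firstForm f x X X), ?_, ?_⟩
  · rw [tangentForm_apply, h.eq_combination hf (quadEnd f q x X), firstForm_quadEnd hf,
      firstForm_quadEnd hf, map_add, map_smul, map_smul]
    module
  · rw [tangentForm_apply, h.eq_combination hf (quadEnd f q x Y), firstForm_quadEnd hf,
      firstForm_quadEnd hf, hq.apply_right_right h, hq.symm x Y X, map_add, map_smul, map_smul,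
      Complex.neg_re]
    module

theorem isSmoothForm_tangentForm (hq : IsQuadraticDifferential o f q) (hf : IsImmersion f) :
    IsSmoothForm (tangentForm f q) := fun U Z hU hZ => by
  refine contMDiffOn_of_locally_contMDiffOn fun x _ => ?_
  obtain ⟨V, X, Y, hxV, h⟩ := hf.exists_conformalFrame o x
  refine ⟨V, h.isOpen, hxV, ?_⟩
  have hUV := hU.inter h.isOpen
  have h' := h.mono hUV Set.inter_subset_right
  have hcoeff {Z' : ∀ x : M, Tan x} (hZ' : SmoothField Z' (U ∩ V)) :
      SmoothOn (fun y => 2 * (q y (Z y) (Z' y)).re / firstForm f y (X y) (X y)) (U ∩ V) :=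
    (contMDiffOn_const.mul (Complex.reCLM.contMDiff.comp_contMDiffOn
      (hq.smooth _ _ _ hUV (hZ.mono Set.inter_subset_left) hZ'))).div₀
      (hf.smoothOn_firstForm hUV h'.smooth_left h'.smooth_left)
      fun y hy => ((h'.pair y hy).firstForm_pos hf).ne'
  have hsum := ContMDiffOn.add
    (ContMDiffOn.smul (hcoeff h'.smooth_left) ((hf.smoothOn _).der hUV h'.smooth_left))
    (ContMDiffOn.smul (hcoeff h'.smooth_right) ((hf.smoothOn _).der hUV h'.smooth_right))
  have hconst : SmoothOn (fun _ => -(1 / 6 : ℝ)) (U ∩ V) := contMDiffOn_const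
  refine ContMDiffOn.congr (ContMDiffOn.smul hconst hsum) fun y hy => ?_
  rw [tangentForm_apply, (h'.pair y hy).eq_combination hf (quadEnd f q y (Z y)),
    firstForm_quadEnd hf, firstForm_quadEnd hf, map_add, map_smul, map_smul]
  rfl

theorem isTangentForm (hq : IsQuadraticDifferential o f q) (hf : IsImmersion f) :
    IsTangentForm f (tangentForm f q) where
  smooth := hq.isSmoothForm_tangentForm hf
  snd x v := by simp [tangentForm_apply, hf.der_snd]
  mink_lift x v := by simp [tangentForm_apply, hf.mink_lift_der]

end IsQuadraticDifferential

end TangentForm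

/-! ### Cauchy-Riemann operator and second fundamental form -/

section Codazzi

variable {M : Type*} [TopologicalSpace M] [ChartedSpace (EuclideanSpace ℝ (Fin 2)) M]
  [IsManifold (𝓡 2) ∞ M] {o : SurfaceOrientation M} {f : M → ProjLightCone} {q : BilinField M}
  {U : Set M} {X Y : ∀ x : M, Tan x} {x : M}

theorem IsImmersion.mdifferentiableAt_der (hf : IsImmersion f) (hU : IsOpen U)
    (hX : SmoothField X U) (hx : x ∈ U) :
    MDifferentiableAt (𝓡 2) 𝓘(ℝ, R41) (fun y => der (lift f) y (X y)) x :=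
  ((hf.smoothOn U).der hU hX).mdifferentiableAt hU hx

theorem IsImmersion.extDer_der_lift (hf : IsImmersion f) (hU : IsOpen U) (hX : SmoothField X U)
    (hY : SmoothField Y U) (hx : x ∈ U) : extDer (der (lift f)) X Y x = 0 :=
  extDer_mvfderiv_eq_zero (((hf.smoothOn U).contMDiffAt hU hx).of_le (WithTop.coe_le_coe.2 le_top))
    (hX.mdifferentiableAt hU hx) (hY.mdifferentiableAt hU hx)
    (hf.mdifferentiableAt_der hU hX hx) (hf.mdifferentiableAt_der hU hY hx)

theorem IsImmersion.der_firstForm (hf : IsImmersion f) (hU : IsOpen U) (hX : SmoothField X U)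
    (hY : SmoothField Y U) (hx : x ∈ U) (v : Tan x) :
    der (fun y => firstForm f y (X y) (Y y)) x v
      = mink (der (fun y => der (lift f) y (X y)) x v) (der (lift f) x (Y x))
        + mink (der (lift f) x (X x)) (der (fun y => der (lift f) y (Y y)) x v) :=
  mvfderiv_bilinear_apply minkL (hf.mdifferentiableAt_der hU hX hx)
    (hf.mdifferentiableAt_der hU hY hx) v

namespace IsConformalFrame

theorem mink_der_der_left_right (h : IsConformalFrame o f X Y U) (hf : IsImmersion f) (hx : x ∈ U)
    (v : Tan x) : mink (der (fun y => der (lift f) y (X y)) x v) (der (lift f) x (Y x))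
      = -mink (der (fun y => der (lift f) y (Y y)) x v) (der (lift f) x (X x)) := by
  have hzero : der (fun y => firstForm f y (X y) (Y y)) x v = 0 := by
    have : (fun y => firstForm f y (X y) (Y y)) =ᶠ[nhds x] fun _ => 0 :=
      Filter.eventually_of_mem (h.isOpen.mem_nhds hx) fun y hy => (h.pair y hy).2.2
    rw [der, this.mfderiv_eq, mfderiv_const]
    rfl
  rw [hf.der_firstForm h.isOpen h.smooth_left h.smooth_right hx, mink_comm (der (lift f) x _)]
    at hzero
  exact eq_neg_of_add_eq_zero_left hzero

theorem mink_der_der_left_left (h : IsConformalFrame o f X Y U) (hf : IsImmersion f) (hx : x ∈ U)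
    (v : Tan x) : mink (der (fun y => der (lift f) y (X y)) x v) (der (lift f) x (X x))
      = mink (der (fun y => der (lift f) y (Y y)) x v) (der (lift f) x (Y x)) := by
  have heq : der (fun y => firstForm f y (X y) (X y)) x v
      = der (fun y => firstForm f y (Y y) (Y y)) x v := by
    have : (fun y => firstForm f y (X y) (X y)) =ᶠ[nhds x] fun y => firstForm f y (Y y) (Y y) :=
      Filter.eventually_of_mem (h.isOpen.mem_nhds hx) fun y hy => (h.pair y hy).2.1
    rw [der, der, this.mfderiv_eq]
  rw [hf.der_firstForm h.isOpen h.smooth_left h.smooth_left hx,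
    hf.der_firstForm h.isOpen h.smooth_right h.smooth_right hx, mink_comm (der (lift f) x (X x)),
    mink_comm (der (lift f) x (Y x)), ← two_mul, ← two_mul] at heq
  exact mul_left_cancel₀ two_ne_zero heq

/-- For `θ = dF ∘ A` with `A` symmetric and trace-free, the second derivatives of `F` in `dθ` cancel
up to `∇_X Y - ∇_Y X = [X, Y]`. -/
theorem mink_der_der_sub (h : IsConformalFrame o f X Y U) (hf : IsImmersion f) (hx : x ∈ U)
    {p r : R41} {a b : ℝ} (hp : p = a • der (lift f) x (X x) + b • der (lift f) x (Y x))
    (hr : r = b • der (lift f) x (X x) - a • der (lift f) x (Y x)) :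
    mink (der (fun y => der (lift f) y (X y)) x (X x)) r
        - mink (der (fun y => der (lift f) y (X y)) x (Y x)) p
      = mink p (der (lift f) x (VectorField.mlieBracket (𝓡 2) X Y x)) ∧
    mink (der (fun y => der (lift f) y (Y y)) x (X x)) r
        - mink (der (fun y => der (lift f) y (Y y)) x (Y x)) p
      = mink r (der (lift f) x (VectorField.mlieBracket (𝓡 2) X Y x)) := by
  have hbracket : der (lift f) x (VectorField.mlieBracket (𝓡 2) X Y x)
      = der (fun y => der (lift f) y (Y y)) x (X x)
        - der (fun y => der (lift f) y (X y)) x (Y x) :=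
    (sub_eq_zero.1 (hf.extDer_der_lift h.isOpen h.smooth_left h.smooth_right hx)).symm
  have hangle := h.mink_der_der_left_right hf hx
  have hlength := h.mink_der_der_left_left hf hx
  subst hp hr
  rw [hbracket, mink_comm (a • _ + b • _), mink_comm (b • _ - a • _)]
  simp only [map_add, map_sub, map_smul, LinearMap.sub_apply, smul_eq_mul, hangle, hlength]
  constructor <;> ring

end IsConformalFrame

/-- The Cauchy-Riemann operator, as it appears in `IsHolomorphic`. -/
def cauchyRiemann (q : BilinField M) (X Y : ∀ x : M, Tan x) (x : M) : ℂ :=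
  der (fun y => q y (X y) (X y)) x (X x) + Complex.I * der (fun y => q y (X y) (X y)) x (Y x)
    + 2 * Complex.I * q x (VectorField.mlieBracket (𝓡 2) X Y x) (X x)

end Codazzi

section ClosedTangentForm

variable {M : Type*} [TopologicalSpace M] [ChartedSpace (EuclideanSpace ℝ (Fin 2)) M]
  [IsManifold (𝓡 2) ∞ M] {o : SurfaceOrientation M} {f : M → ProjLightCone} {q : BilinField M}
  {U : Set M} {X Y : ∀ x : M, Tan x} {x : M}

namespace IsConformalFrame

theorem extDer_flip_left (h : IsConformalFrame o f X Y U) (hq : IsQuadraticDifferential o f q)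
    (hx : x ∈ U) : extDer (fun y => (q y).flip (X y)) X Y x
      = Complex.I * cauchyRiemann q X Y x
        + q x (VectorField.mlieBracket (𝓡 2) X Y x) (X x) := by
  have hXX : MDifferentiableAt (𝓡 2) 𝓘(ℝ, ℂ) (fun y => q y (X y) (X y)) x :=
    SmoothOn.mdifferentiableAt (hq.smooth _ _ _ h.isOpen h.smooth_left h.smooth_left) h.isOpen hx
  have hYX : (fun y => q y (Y y) (X y)) =ᶠ[nhds x] fun y => Complex.I * q y (X y) (X y) :=
    Filter.eventually_of_mem (h.isOpen.mem_nhds hx) fun y hy =>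
      hq.type_two_zero y _ _ (h.pair y hy) _
  have hder (v : Tan x) : der (fun y => q y (Y y) (X y)) x v
      = Complex.I * der (fun y => q y (X y) (X y)) x v := by
    rw [der, hYX.mfderiv_eq]
    exact mvfderiv_clm_apply (ContinuousLinearMap.mul ℝ ℂ Complex.I) hXX v
  change der (fun y => q y (Y y) (X y)) x (X x) - der (fun y => q y (X y) (X y)) x (Y x)
    - q x (VectorField.mlieBracket (𝓡 2) X Y x) (X x) = _
  rw [hder, cauchyRiemann]
  linear_combination (-der (fun y => q y (X y) (X y)) x (Y x)
    - 2 * q x (VectorField.mlieBracket (𝓡 2) X Y x) (X x)) * Complex.I_sq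

theorem extDer_flip_right (h : IsConformalFrame o f X Y U) (hq : IsQuadraticDifferential o f q)
    (hx : x ∈ U) : extDer (fun y => (q y).flip (Y y)) X Y x
      = Complex.I * extDer (fun y => (q y).flip (X y)) X Y x := by
  have hmul : ∀ᶠ y in nhds x, (q y).flip (Y y)
      = (ContinuousLinearMap.mul ℝ ℂ Complex.I).toLinearMap ∘ₗ (q y).flip (X y) :=
    Filter.eventually_of_mem (h.isOpen.mem_nhds hx) fun y hy =>
      LinearMap.ext (hq.apply_right (h.pair y hy))
  have hqX {Z : ∀ x : M, Tan x} (hZ : SmoothField Z U) :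
      MDifferentiableAt (𝓡 2) 𝓘(ℝ, ℂ) (fun y => (q y).flip (X y) (Z y)) x :=
    SmoothOn.mdifferentiableAt (hq.smooth _ _ _ h.isOpen hZ h.smooth_left) h.isOpen hx
  rw [extDer_congr_form hmul, extDer_clm_comp _ (hqX h.smooth_left) (hqX h.smooth_right)]
  rfl

theorem mink_der_extDer_add (h : IsConformalFrame o f X Y U) (hf : IsImmersion f)
    (hq : IsQuadraticDifferential o f q) {Z : ∀ x : M, Tan x} (hZ : SmoothField Z U) (hx : x ∈ U) :
    mink (der (fun y => der (lift f) y (Z y)) x (X x)) (tangentForm f q x (Y x))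
        - mink (der (fun y => der (lift f) y (Z y)) x (Y x)) (tangentForm f q x (X x))
        + mink (der (lift f) x (Z x)) (extDer (tangentForm f q) X Y x)
      = -(1 / 3) * (extDer (fun y => (q y).flip (Z y)) X Y x).re := by
  have hθ := hq.isSmoothForm_tangentForm hf
  have hcomp : (fun y => (minkL (der (lift f) y (Z y))).toLinearMap ∘ₗ tangentForm f q y)
      = fun y => (-(1 / 3 : ℝ) • Complex.reCLM).toLinearMap ∘ₗ (q y).flip (Z y) :=
    funext fun y => LinearMap.ext fun v => (mink_comm _ _).trans (mink_tangentForm hf q y v _)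
  have hqZ {W : ∀ x : M, Tan x} (hW : SmoothField W U) :
      MDifferentiableAt (𝓡 2) 𝓘(ℝ, ℂ) (fun y => (q y).flip (Z y) (W y)) x :=
    SmoothOn.mdifferentiableAt (hq.smooth _ _ _ h.isOpen hW hZ) h.isOpen hx
  have hbilin := extDer_bilinear minkL (hf.mdifferentiableAt_der h.isOpen hZ hx)
    (hθ.mdifferentiableAt h.isOpen h.smooth_left hx)
    (hθ.mdifferentiableAt h.isOpen h.smooth_right hx)
  rw [hcomp, extDer_clm_comp _ (hqZ h.smooth_left) (hqZ h.smooth_right)] at hbilin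
  exact hbilin.symm

theorem mink_der_extDer_tangentForm (h : IsConformalFrame o f X Y U) (hf : IsImmersion f)
    (hq : IsQuadraticDifferential o f q) (hx : x ∈ U) :
    mink (der (lift f) x (X x)) (extDer (tangentForm f q) X Y x)
      = 1 / 3 * (cauchyRiemann q X Y x).im ∧
    mink (der (lift f) x (Y x)) (extDer (tangentForm f q) X Y x)
      = 1 / 3 * (cauchyRiemann q X Y x).re := by
  obtain ⟨a, b, hX, hY⟩ := hq.isSymmetricTraceFree_tangentForm hf x _ _ (h.pair x hx)
  obtain ⟨hcodazziX, hcodazziY⟩ := h.mink_der_der_sub hf hx hX hY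
  have hleft := h.mink_der_extDer_add hf hq h.smooth_left hx
  have hright := h.mink_der_extDer_add hf hq h.smooth_right hx
  rw [hcodazziX, mink_tangentForm hf, hq.symm, h.extDer_flip_left hq hx, Complex.add_re,
    Complex.I_mul_re] at hleft
  rw [hcodazziY, mink_tangentForm hf, hq.type_two_zero x _ _ (h.pair x hx), hq.symm,
    h.extDer_flip_right hq hx, h.extDer_flip_left hq hx, mul_add, Complex.add_re, ← mul_assoc,
    Complex.I_mul_I, neg_one_mul, Complex.neg_re] at hright
  exact ⟨by linear_combination hleft, by linear_combination hright⟩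

end IsConformalFrame

namespace IsUnitNormal

variable {N : M → R41}

theorem mink_extDer_tangentForm (hN : IsUnitNormal f N U) (h : IsConformalFrame o f X Y U)
    (hf : IsImmersion f) (hq : IsQuadraticDifferential o f q) (hx : x ∈ U) :
    mink (N x) (extDer (tangentForm f q) X Y x)
      = 1 / 6 * (secondForm f N x (Y x) (quadEnd f q x (X x))
        - secondForm f N x (X x) (quadEnd f q x (Y x))) := by
  have hθ := hq.isSmoothForm_tangentForm hf
  have hzero : ∀ᶠ y in nhds x, ∀ v, minkL (N y) (tangentForm f q y v) = 0 :=
    Filter.eventually_of_mem (h.isOpen.mem_nhds hx) fun y hy v => by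
      rw [tangentForm_apply, map_smul]
      exact (congrArg _ (hN.normal y hy _)).trans (smul_zero _)
  have hbilin : mink (N x) (extDer (tangentForm f q) X Y x)
      = mink (der N x (Y x)) (tangentForm f q x (X x))
        - mink (der N x (X x)) (tangentForm f q x (Y x)) :=
    bilinear_extDer_of_eventually_eq_zero minkL hzero (hN.smooth.mdifferentiableAt h.isOpen hx)
      (hθ.mdifferentiableAt h.isOpen h.smooth_left hx)
      (hθ.mdifferentiableAt h.isOpen h.smooth_right hx)
  rw [hbilin, tangentForm_apply, tangentForm_apply, map_smul, map_smul, secondForm]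
  simp only [LinearMap.neg_apply, LinearMap.compl₁₂_apply, smul_eq_mul]
  ring

theorem secondForm_comm (hN : IsUnitNormal f N U) (h : IsConformalFrame o f X Y U)
    (hf : IsImmersion f) (hx : x ∈ U) (v w : Tan x) :
    secondForm f N x v w = secondForm f N x w v := by
  refine (h.pair x hx).1.apply_comm ?_ v w
  have hzero : ∀ᶠ y in nhds x, ∀ v, minkL (N y) (der (lift f) y v) = 0 :=
    Filter.eventually_of_mem (h.isOpen.mem_nhds hx) hN.normal
  have hbilin := bilinear_extDer_of_eventually_eq_zero minkL hzero
    (hN.smooth.mdifferentiableAt h.isOpen hx)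
    (hf.mdifferentiableAt_der h.isOpen h.smooth_left hx)
    (hf.mdifferentiableAt_der h.isOpen h.smooth_right hx)
  rw [hf.extDer_der_lift h.isOpen h.smooth_left h.smooth_right hx, map_zero] at hbilin
  exact congrArg Neg.neg (sub_eq_zero.1 hbilin.symm).symm

theorem commute_iff (hN : IsUnitNormal f N U) (h : IsConformalFrame o f X Y U)
    (hf : IsImmersion f) (hq : IsQuadraticDifferential o f q) (hx : x ∈ U) :
    quadEnd f q x ∘ₗ raise (firstForm f x) (tracefreeSecondForm f N x)
      = raise (firstForm f x) (tracefreeSecondForm f N x) ∘ₗ quadEnd f q x ↔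
    mink (N x) (extDer (tangentForm f q) X Y x) = 0 := by
  have hsymm (v w : Tan x) : tracefreeSecondForm f N x v w = tracefreeSecondForm f N x w v := by
    simp only [tracefreeSecondForm, LinearMap.sub_apply, LinearMap.smul_apply,
      hN.secondForm_comm h hf hx v, firstForm_comm f x v]
  have hQ (v w : Tan x) :
      firstForm f x v (quadEnd f q x w) = firstForm f x w (quadEnd f q x v) := by
    rw [firstForm_comm, firstForm_quadEnd hf, firstForm_comm, firstForm_quadEnd hf, hq.symm]
  have htracefree (v w : Tan x) : tracefreeSecondForm f N x v (quadEnd f q x w)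
        = tracefreeSecondForm f N x w (quadEnd f q x v) ↔
      secondForm f N x v (quadEnd f q x w) = secondForm f N x w (quadEnd f q x v) := by
    simp only [tracefreeSecondForm, LinearMap.sub_apply, LinearMap.smul_apply, hQ v w,
      sub_left_inj]
  rw [hN.mink_extDer_tangentForm h hf hq hx, quadEnd,
    raise_comm_iff (hf.nondegenerate_firstForm x) (firstForm_comm f x)
      (fun v w => by rw [realForm_apply, hq.symm, realForm_apply]) hsymm, ← quadEnd]
  simp only [htracefree, mul_eq_zero, sub_eq_zero, one_div, inv_eq_zero, OfNat.ofNat_ne_zero,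
    false_or]
  exact ⟨fun hall => hall _ _, fun hXY => (h.pair x hx).1.apply_comm
    (B := (secondForm f N x).compl₂ (quadEnd f q x)) hXY.symm⟩

end IsUnitNormal

namespace IsConformalFrame

theorem extDer_tangentForm_eq_zero_iff (h : IsConformalFrame o f X Y U) {N : M → R41}
    (hN : IsUnitNormal f N U) (hf : IsImmersion f) (hq : IsQuadraticDifferential o f q)
    (hx : x ∈ U) : extDer (tangentForm f q) X Y x = 0 ↔ cauchyRiemann q X Y x = 0 ∧
      mink (N x) (extDer (tangentForm f q) X Y x) = 0 := by
  obtain ⟨hXθ, hYθ⟩ := h.mink_der_extDer_tangentForm hf hq hx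
  constructor
  · intro hzero
    rw [hzero, map_zero] at hXθ hYθ ⊢
    exact ⟨Complex.ext (by simpa using hYθ.symm) (by simpa using hXθ.symm), rfl⟩
  · rintro ⟨hCR, hNθ⟩
    rw [hCR, Complex.zero_im, mul_zero] at hXθ
    rw [hCR, Complex.zero_re, mul_zero] at hYθ
    have hθ := hq.isTangentForm hf
    refine hN.eq_zero_of_mink_eq_zero hx (h.pair x hx) hf
      (hθ.extDer_snd h.isOpen h.smooth_left h.smooth_right hx) ?_ hXθ hYθ hNθ
    rw [hθ.mink_lift_extDer hf h.isOpen h.smooth_left h.smooth_right hx, mink_comm,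
      mink_tangentForm hf, mink_comm, mink_tangentForm hf, hq.symm, sub_self]

end IsConformalFrame

theorem IsQuadraticDifferential.isClosedForm_tangentForm_iff (hq : IsQuadraticDifferential o f q)
    (hf : IsImmersion f) : IsClosedForm (tangentForm f q) ↔
      IsHolomorphic o f q ∧ CommutesWithSecondForm f q := by
  constructor
  · refine fun hclosed => ⟨fun U X Y hU hX hY hXY x hx => ?_, fun U N hU hN x hx => ?_⟩
    · obtain ⟨V, N, hxV, h, hN⟩ :=
        IsConformalFrame.exists_isUnitNormal ⟨hU, hX, hY, hXY⟩ hf hx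
      exact ((h.extDer_tangentForm_eq_zero_iff hN hf hq hxV).1
        (hclosed V X Y h.isOpen h.smooth_left h.smooth_right x hxV)).1
    · obtain ⟨V, X, Y, hxV, h⟩ := hf.exists_conformalFrame o x
      have h' := h.mono (hU.inter h.isOpen) Set.inter_subset_right
      rw [(hN.mono Set.inter_subset_left).commute_iff h' hf hq ⟨hx, hxV⟩,
        hclosed V X Y h.isOpen h.smooth_left h.smooth_right x hxV, map_zero]
  · rintro ⟨hhol, hcomm⟩ U Z Z' hU hZ hZ' x hx
    obtain ⟨V, X, Y, hxV, h⟩ := hf.exists_conformalFrame o x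
    obtain ⟨V', N, hxV', h', hN⟩ := h.exists_isUnitNormal hf hxV
    refine h'.extDer_eq_zero hf (hq.isSmoothForm_tangentForm hf) hxV' ?_ hU hZ hZ' hx
    refine (h'.extDer_tangentForm_eq_zero_iff hN hf hq hxV').2
      ⟨hhol V' X Y h'.isOpen h'.smooth_left h'.smooth_right h'.pair x hxV', ?_⟩
    exact (hN.commute_iff h' hf hq hxV').1 (hcomm V' N h'.isOpen hN x hxV')

theorem IsQuadraticDifferential.isClosed_associatedForm_iff
    (hq : IsQuadraticDifferential o f q) (hf : IsImmersion f) : (associatedForm f q).IsClosed ↔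
      IsHolomorphic o f q ∧ CommutesWithSecondForm f q := by
  rw [← wedgeForm_tangentForm, (hq.isTangentForm hf).isClosed_wedgeForm_iff o hf,
    hq.isClosedForm_tangentForm_iff hf,
    and_iff_left (hq.isSymmetricTraceFree_tangentForm hf)]

end ClosedTangentForm

/-! ### From closed one-forms to quadratic differentials -/

section ComplexStructure

variable {M : Type*} [TopologicalSpace M] [ChartedSpace (EuclideanSpace ℝ (Fin 2)) M]

/-- The form `(B (v, w) - i B (v, J w)) / 2`, which is of type `(2,0)` if `B` is symmetric and
trace-free, and then has `B` as the sum with its conjugate. -/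
def twoZeroPart (J : ∀ x : M, Tan x →ₗ[ℝ] Tan x) (B : ∀ x : M, LinearMap.BilinForm ℝ (Tan x)) :
    BilinField M := fun x =>
  (B x).compr₂ (LinearMap.toSpanSingleton ℝ ℂ (1 / 2))
    + ((B x).compl₂ (J x)).compr₂ (LinearMap.toSpanSingleton ℝ ℂ (-(Complex.I / 2)))

theorem twoZeroPart_apply (J : ∀ x : M, Tan x →ₗ[ℝ] Tan x)
    (B : ∀ x : M, LinearMap.BilinForm ℝ (Tan x)) (x : M) (v w : Tan x) :
    twoZeroPart J B x v w = B x v w • (1 / 2 : ℂ) + B x v (J x w) • (-(Complex.I / 2)) := rfl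

theorem realForm_twoZeroPart (J : ∀ x : M, Tan x →ₗ[ℝ] Tan x)
    (B : ∀ x : M, LinearMap.BilinForm ℝ (Tan x)) : realForm (twoZeroPart J B) = B := by
  funext x
  ext v w
  rw [realForm_apply, twoZeroPart_apply]
  simp only [Complex.add_re, Complex.real_smul, Complex.re_ofReal_mul, Complex.neg_re,
    Complex.div_ofNat_re, Complex.one_re, Complex.I_re]
  ring

variable [IsManifold (𝓡 2) ∞ M] {o : SurfaceOrientation M} {f : M → ProjLightCone}

/-- A real bilinear form is smooth if it takes smooth vector fields to smooth functions. -/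
def IsSmoothBilinForm (B : ∀ x : M, LinearMap.BilinForm ℝ (Tan x)) : Prop :=
  ∀ (U : Set M) (X Y : ∀ x : M, Tan x), IsOpen U → SmoothField X U → SmoothField Y U →
    SmoothOn (fun x => B x (X x) (Y x)) U

/-- `J` is the rotation by a right angle for the orientation `o` and the conformal structure induced
by `f`. -/
def IsComplexStructure (o : SurfaceOrientation M) (f : M → ProjLightCone)
    (J : ∀ x : M, Tan x →ₗ[ℝ] Tan x) : Prop :=
  ∀ (x : M) (X Y : Tan x), IsConformalPair o f x X Y → J x X = Y

theorem IsImmersion.exists_isComplexStructure (hf : IsImmersion f) (o : SurfaceOrientation M) :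
    ∃ J, IsComplexStructure o f J := by
  have hJ (x : M) : ∃ J : Tan x →ₗ[ℝ] Tan x, ∀ X Y, IsConformalPair o f x X Y → J X = Y := by
    obtain ⟨_, X, Y, hx, h⟩ := hf.exists_conformalFrame o x
    obtain ⟨e, hX, hY, -⟩ := (h.pair x hx).1
    have hJX : e.constr ℝ ![Y x, -X x] (X x) = Y x := by rw [← hX, e.constr_basis]; rfl
    have hJY : e.constr ℝ ![Y x, -X x] (Y x) = -X x := by rw [← hY, e.constr_basis, hY]; rfl
    refine ⟨e.constr ℝ ![Y x, -X x], fun X' Y' h' => ?_⟩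
    obtain ⟨a, b, rfl, rfl⟩ := (h.pair x hx).exists_rotation h' hf
    rw [map_add, map_smul, map_smul, hJX, hJY]
    module
  choose J hJ using hJ
  exact ⟨J, hJ⟩

namespace IsComplexStructure

variable {J : ∀ x : M, Tan x →ₗ[ℝ] Tan x}

theorem apply_right (hJ : IsComplexStructure o f J) {x : M} {X Y : Tan x}
    (h : IsConformalPair o f x X Y) : J x Y = -X := by
  simpa using hJ x _ _ (h.rotate (a := 0) (b := 1) (by simp))

theorem exists_smoothField (hJ : IsComplexStructure o f J) (hf : IsImmersion f) {U : Set M}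
    (hU : IsOpen U) {Z : ∀ x : M, Tan x} (hZ : SmoothField Z U) (x : M) :
    ∃ (V : Set M) (Z' : ∀ x : M, Tan x), IsOpen V ∧ x ∈ V ∧ SmoothField Z' (U ∩ V) ∧
      ∀ y ∈ U ∩ V, J y (Z y) = Z' y := by
  obtain ⟨V, X, Y, hxV, h⟩ := hf.exists_conformalFrame o x
  have h' := h.mono (hU.inter h.isOpen) Set.inter_subset_right
  obtain ⟨a, b, ha, hb, hab⟩ := h'.exists_coeff hf (hZ.mono Set.inter_subset_left)
  refine ⟨V, (-b) • X + a • Y, h.isOpen, hxV, (h'.smooth_left.smul hb.neg).add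
    (h'.smooth_right.smul ha), fun y hy => ?_⟩
  rw [hab y hy]
  simp only [Pi.add_apply, Pi.smul_apply', Pi.neg_apply, map_add, map_smul,
    hJ y _ _ (h'.pair y hy), hJ.apply_right (h'.pair y hy)]
  module

end IsComplexStructure

variable {J : ∀ x : M, Tan x →ₗ[ℝ] Tan x} {B : ∀ x : M, LinearMap.BilinForm ℝ (Tan x)}

theorem IsComplexStructure.smooth_twoZeroPart (hJ : IsComplexStructure o f J) (hf : IsImmersion f)
    (hB : IsSmoothBilinForm B) {U : Set M} {X Y : ∀ x : M, Tan x} (hU : IsOpen U)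
    (hX : SmoothField X U) (hY : SmoothField Y U) :
    SmoothOn (fun x => twoZeroPart J B x (X x) (Y x)) U := by
  refine contMDiffOn_of_locally_contMDiffOn fun x _ => ?_
  obtain ⟨V, Y', hV, hxV, hY', hJY⟩ := hJ.exists_smoothField hf hU hY x
  refine ⟨V, hV, hxV, ?_⟩
  have hUV := hU.inter hV
  have hX' : SmoothField X (U ∩ V) := hX.mono Set.inter_subset_left
  have hconst (c : ℂ) : SmoothOn (fun _ => c) (U ∩ V) := contMDiffOn_const
  refine ContMDiffOn.congr (ContMDiffOn.add
    (ContMDiffOn.smul (hB _ X Y hUV hX' (hY.mono Set.inter_subset_left)) (hconst (1 / 2)))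
    (ContMDiffOn.smul (hB _ X Y' hUV hX' hY') (hconst (-(Complex.I / 2))))) fun y hy => ?_
  rw [twoZeroPart_apply, hJY y hy]
  rfl

theorem IsComplexStructure.isQuadraticDifferential_twoZeroPart (hJ : IsComplexStructure o f J)
    (hf : IsImmersion f) (hB : IsSmoothBilinForm B) (hsymm : ∀ x v w, B x v w = B x w v)
    (htrace : ∀ x X Y, IsConformalPair o f x X Y → B x X X + B x Y Y = 0) :
    IsQuadraticDifferential o f (twoZeroPart J B) := by
  have hBJ (x : M) (v w : Tan x) : B x v (J x w) = B x w (J x v) := by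
    obtain ⟨_, X, Y, hx, h⟩ := hf.exists_conformalFrame o x
    have hpair := h.pair x hx
    refine hpair.1.apply_comm (B := (B x).compl₂ (J x)) ?_ v w
    rw [LinearMap.compl₂_apply, LinearMap.compl₂_apply, hJ x _ _ hpair, hJ.apply_right hpair,
      map_neg]
    exact neg_eq_of_add_eq_zero_right (htrace x _ _ hpair)
  refine ⟨fun U X Y hU hX hY => hJ.smooth_twoZeroPart hf hB hU hX hY, fun x v w => ?_,
    fun x X Y h Z => ?_⟩
  · rw [twoZeroPart_apply, twoZeroPart_apply, hsymm, hBJ]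
  · rw [twoZeroPart_apply, twoZeroPart_apply, hBJ x X, hBJ x Y, hJ x X Y h, hJ.apply_right h,
      map_neg, hsymm x Z Y, hsymm x Z X]
    simp only [Complex.real_smul, Complex.ofReal_neg]
    linear_combination (B x Y Z / 2 : ℂ) * Complex.I_sq

end ComplexStructure

section Converse

variable {M : Type*} [TopologicalSpace M] [ChartedSpace (EuclideanSpace ℝ (Fin 2)) M]
  {f : M → ProjLightCone}

theorem tangentForm_eq_of_realForm_eq {q : BilinField M} {θ : ∀ x : M, Tan x →ₗ[ℝ] R41}
    (hf : IsImmersion f) (hrange : ∀ x v, ∃ z, θ x v = der (lift f) x z)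
    (hq : ∀ x v w, realForm q x v w = -6 * mink (θ x v) (der (lift f) x w)) :
    tangentForm f q = θ := by
  funext x
  ext1 v
  obtain ⟨z, hz⟩ := hrange x v
  have hzero : quadEnd f q x v + (6 : ℝ) • z = 0 := (hf.nondegenerate_firstForm x).1 _ fun w => by
    rw [map_add, LinearMap.add_apply, firstForm_quadEnd hf, ← realForm_apply, hq, hz, map_smul,
      LinearMap.smul_apply, firstForm_apply, smul_eq_mul]
    ring
  rw [tangentForm_apply, eq_neg_of_add_eq_zero_left hzero, hz, map_neg, map_smul]
  module

variable [IsManifold (𝓡 2) ∞ M] {o : SurfaceOrientation M} {θ : ∀ x : M, Tan x →ₗ[ℝ] R41}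

namespace IsSymmetricTraceFree

theorem exists_eq_der (hθ : IsSymmetricTraceFree o f θ) (hf : IsImmersion f) (x : M) (v : Tan x) :
    ∃ z, θ x v = der (lift f) x z := by
  obtain ⟨_, X, Y, hx, h⟩ := hf.exists_conformalFrame o x
  obtain ⟨a, b, hX, hY⟩ := hθ x _ _ (h.pair x hx)
  obtain ⟨c, d, rfl⟩ := (h.pair x hx).1.exists_eq v
  refine ⟨c • (a • X x + b • Y x) + d • (b • X x - a • Y x), ?_⟩
  simp only [map_add, map_sub, map_smul, hX, hY]

theorem mink_der_comm (hθ : IsSymmetricTraceFree o f θ) (hf : IsImmersion f) (x : M)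
    (v w : Tan x) : mink (θ x v) (der (lift f) x w) = mink (θ x w) (der (lift f) x v) := by
  obtain ⟨_, X, Y, hx, h⟩ := hf.exists_conformalFrame o x
  obtain ⟨a, b, hX, hY⟩ := hθ x _ _ (h.pair x hx)
  refine (h.pair x hx).1.apply_comm (B := mink.compl₁₂ (θ x) (der (lift f) x)) ?_ v w
  rw [LinearMap.compl₁₂_apply, LinearMap.compl₁₂_apply, hX, hY]
  simp only [map_add, map_sub, map_smul, LinearMap.add_apply, LinearMap.sub_apply,
    LinearMap.smul_apply, ← firstForm_apply, (h.pair x hx).2.2, (h.pair x hx).2.1,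
    firstForm_comm f x (Y x), smul_zero, zero_add, sub_zero]

theorem mink_der_add_eq_zero (hθ : IsSymmetricTraceFree o f θ) {x : M} {X Y : Tan x}
    (h : IsConformalPair o f x X Y) :
    mink (θ x X) (der (lift f) x X) + mink (θ x Y) (der (lift f) x Y) = 0 := by
  obtain ⟨a, b, hX, hY⟩ := hθ x X Y h
  simp only [hX, hY, map_add, map_sub, map_smul, LinearMap.add_apply, LinearMap.sub_apply,
    LinearMap.smul_apply, ← firstForm_apply, h.2.2, h.2.1, firstForm_comm f x Y X, smul_zero,
    add_zero, zero_sub, add_neg_cancel]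

end IsSymmetricTraceFree

theorem IsSmoothForm.exists_tangentForm_eq (hθ : IsSmoothForm θ) (hf : IsImmersion f)
    (hθf : IsSymmetricTraceFree o f θ) :
    ∃ q, IsQuadraticDifferential o f q ∧ tangentForm f q = θ := by
  obtain ⟨J, hJ⟩ := hf.exists_isComplexStructure o
  let B (x : M) : LinearMap.BilinForm ℝ (Tan x) := (-6 : ℝ) • mink.compl₁₂ (θ x) (der (lift f) x)
  have hB (x : M) (v w : Tan x) : B x v w = -6 * mink (θ x v) (der (lift f) x w) := rfl
  have hsmooth : IsSmoothBilinForm B := fun U X Y hU hX hY =>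
    ContMDiffOn.mul (contMDiffOn_const (c := (-6 : ℝ)))
      ((hθ U X hU hX).bilinear minkL ((hf.smoothOn U).der hU hY))
  refine ⟨twoZeroPart J B, hJ.isQuadraticDifferential_twoZeroPart hf hsmooth (fun x v w => ?_)
    (fun x X Y h => ?_), tangentForm_eq_of_realForm_eq hf (hθf.exists_eq_der hf) fun x v w => ?_⟩
  · rw [hB, hB, hθf.mink_der_comm hf]
  · rw [hB, hB, ← mul_add, hθf.mink_der_add_eq_zero h, mul_zero]
  · rw [realForm_twoZeroPart, hB]

theorem IsImmersion.exists_associatedForm_eq (hf : IsImmersion f) (o : SurfaceOrientation M)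
    {η : OneForm M} (hη : η.IsSmooth) (hclosed : η.IsClosed)
    (hηf : η.TakesValuesInNilradical f) :
    ∃ q, IsQuadraticDifferential o f q ∧ associatedForm f q = η := by
  have hθ := hη.isTangentForm_vectorForm hηf
  rw [← hηf.wedgeForm_vectorForm, hθ.isClosed_wedgeForm_iff o hf] at hclosed
  obtain ⟨q, hq, hqθ⟩ := hθ.smooth.exists_tangentForm_eq hf hclosed.2
  exact ⟨q, hq, by rw [← wedgeForm_tangentForm, hqθ, hηf.wedgeForm_vectorForm]⟩

theorem IsQuadraticDifferential.associatedForm_eq_zero_iff {q : BilinField M}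
    (hq : IsQuadraticDifferential o f q) (hf : IsImmersion f) {x : M} :
    associatedForm f q x = 0 ↔ q x = 0 := by
  constructor
  · intro h
    have hre (v w : Tan x) : (q x v w).re = 0 := by
      have hv : tangentForm f q x v = 0 := by
        have ht0 := congrArg (fun A : Tan x →ₗ[ℝ] so41 => (A v).1 t0) h
        rw [← wedgeForm_tangentForm] at ht0
        simpa [wedgeForm, wedge_apply_t0, (hq.isTangentForm hf).snd, lift_snd] using ht0
      have hmink := mink_tangentForm hf q x v w
      rw [hv, map_zero, LinearMap.zero_apply] at hmink
      linarith
    obtain ⟨_, X, Y, hx, hXY⟩ := hf.exists_conformalFrame o x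
    have hY := hq.type_two_zero x _ _ (hXY.pair x hx)
    have hX (w : Tan x) : q x (X x) w = 0 :=
      Complex.ext (hre _ _) (by simpa [hY] using hre (Y x) w)
    ext v w
    obtain ⟨a, b, rfl⟩ := (hXY.pair x hx).1.exists_eq v
    simp [hX, hY]
  · intro h
    ext1 v
    have hv : quadEnd f q x v = 0 := (hf.nondegenerate_firstForm x).1 _ fun w => by
      rw [firstForm_quadEnd hf, h]
      simp
    simp [associatedForm, hv]

end Converse

end Isothermic

end

theorem mainTheorem6 {M : Type*} [TopologicalSpace M]
    [ChartedSpace (EuclideanSpace ℝ (Fin 2)) M] [IsManifold (𝓡 2) ∞ M]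
    (o : Isothermic.SurfaceOrientation M) (f : M → Isothermic.ProjLightCone)
    (hf : Isothermic.IsImmersion f) :
    (Isothermic.IsIsothermic o f ↔
      ∃ η : Isothermic.OneForm M, η.IsSmooth ∧ (∃ x, η x ≠ 0) ∧ η.IsClosed ∧
        η.TakesValuesInNilradical f) ∧
    (∀ q : Isothermic.BilinField M, Isothermic.IsQuadraticDifferential o f q →
      (Isothermic.associatedForm f q).IsSmooth ∧
      (Isothermic.associatedForm f q).TakesValuesInNilradical f ∧
      (Isothermic.IsHolomorphic o f q ∧ Isothermic.CommutesWithSecondForm f q ↔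
        (Isothermic.associatedForm f q).IsClosed)) ∧
    (∀ η : Isothermic.OneForm M, η.IsSmooth → η.IsClosed → η.TakesValuesInNilradical f →
      ∃ q : Isothermic.BilinField M, Isothermic.IsQuadraticDifferential o f q ∧
        Isothermic.associatedForm f q = η) := by
  refine ⟨⟨?_, ?_⟩, fun q hq => ⟨?_, ?_, ?_⟩, ?_⟩
  · rintro ⟨q, hq, ⟨x, hx⟩, hol⟩
    exact ⟨Isothermic.associatedForm f q, (hq.isTangentForm hf).isSmooth_wedgeForm hf,
      ⟨x, (hq.associatedForm_eq_zero_iff hf).not.2 hx⟩, (hq.isClosed_associatedForm_iff hf).2 hol,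
      (hq.isTangentForm hf).takesValuesInNilradical_wedgeForm⟩
  · rintro ⟨η, hη, ⟨x, hx⟩, hclosed, hηf⟩
    obtain ⟨q, hq, rfl⟩ := hf.exists_associatedForm_eq o hη hclosed hηf
    exact ⟨q, hq, ⟨x, (hq.associatedForm_eq_zero_iff hf).not.1 hx⟩,
      (hq.isClosed_associatedForm_iff hf).1 hclosed⟩
  · exact (hq.isTangentForm hf).isSmooth_wedgeForm hf
  · exact (hq.isTangentForm hf).takesValuesInNilradical_wedgeForm
  · exact (hq.isClosed_associatedForm_iff hf).symm
  · exact fun η hη hclosed hηf => hf.exists_associatedForm_eq o hη hclosed hηf
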